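/- Let $f:[0,\infty)\to(0,\infty)$ be continuous, convex, vanishing at $+\infty$ and three times differentiable on $(0,\infty)$ (the right derivative at $0$ may be $-\infty$). For $x$ large let $x_t=x_t(x)\in(0,x)$ be the unique solution of $\frac{f(x)+f(x_t)}{x-x_t}=-f'(x_t)$. Assume that, as $x\to+\infty$, (A1) $f''(x)\to 0$; (A2) $|f'(x_t)|\le C|f'(x)|$ for some constant $C$ and all large $x$; (A3) $f(x)f''(x)/f'(x)^2$ is bounded away from $0$; (A4) $f''>0$ on $(0,\infty)$ and $|f'''(x)|/f''(x)$ is bounded for large $x$. Consider the billiard in $Q=\{x\ge 0,\ 0\le y\le f(x)\}$ and the return map $T$ to the dispersing wall $\{y=f(x)\}$. Its phase space is $\mathcal M=(0,\infty)\times(0,\pi)\ni(r,\varphi)$, where $r$ is arc length along the wall measured from the vertex $V=(0,f(0))$ and $\varphi$ is the angle between $\partial/\partial r$ and the outgoing velocity. Let $\mathrm{Leb}$ be the Lebesgue measure on $\mathcal M$ and $d\mu=\sin\varphi\,dr\,d\varphi$. Unfold $Q$ to $Q_4=\{|y|\le f(|x|)\}$, so that trajectories between collisions with the wall are straight segments,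 and put: - $F^{0+}=[0,\infty)\times\{\pi\}$; - $F^{1+}$: the set of elements of $\mathcal M$ whose next collision in $Q_4$ is tangential and in the quadrant $\{x<0<y\}$ (a tangency to the wall after a rebound on the vertical side); - $F^{2+}$: the set of elements of $\mathcal M$ whose next collision in $Q_4$ has $y<0$, $x\ge 0$ and either is at the vertex $(0,-f(0))$ or is tangential (after a rebound on the horizontal side); - $F^{i-}$: the image of $F^{i+}$ under $(r,\varphi)\mapsto(r,\pi-\varphi)$; $F^\pm=F^{1\pm}\cup F^{2\pm}$. For $\zeta\in\mathcal M\setminus F^-$ let $\mathcal C_1(\zeta)=DT_{T^{-1}\zeta}\{(dr,d\varphi): dr\,d\varphi\le 0\}$. An unstable curve from $\zeta$ to $w$ is a continuous $\gamma:[0,1]\to\mathbb R^2$ with $\gamma(0)=\zeta$, $\gamma(1)=w$ which on $(0,1)$ takes values in $\mathcal M$, is differentiable, and satisfies $\gamma'(t)\in\mathcal C_1(\gamma(t))$ whenever $\gamma(t)\notin F^-$. The unstable distance $d^u(\zeta,w)$ is the infimum of the Euclidean lengths of the unstable curves from $\zeta$ to $w$ ($+\infty$ if there is none), $d^u(\zeta,A)=\inf_{w\in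 A}d^u(\zeta,w)$, and $A_{[\varepsilon]}=\{\zeta\in\mathcal M: d^u(\zeta,A)\le\varepsilon\}$. Then for $i=0,1,2$ and each choice of sign there are $C,\varepsilon_0>0$ such that for all $0<\varepsilon\le\varepsilon_0$ $$\mu\big(F^{i\pm}_{[\varepsilon]}\big)\le \mathrm{Leb}\big(F^{i\pm}_{[\varepsilon]}\big)\le C\varepsilon .$$ Moreover each $F^{i\pm}$ has infinite length (its one-dimensional Hausdorff measure is $+\infty$). -/

import Mathlib

open Set Filter Topology MeasureTheory Asymptotics
open scoped ENNReal

namespace CuspBilliard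

noncomputable section

/-! ### The table and the assumptions on its profile -/

/-- Standing assumptions on `f : [0, ∞) → (0, ∞)`: continuous, convex, vanishing at infinity (hence
nonincreasing and bounded), three times differentiable on `(0, ∞)`. The right derivative at `0` may
be finite or `-∞`, so the vertex `V = (0, f 0)` is either a corner or a cusp. -/
structure IsProfile (f : ℝ → ℝ) : Prop where
  pos : ∀ x, 0 ≤ x → 0 < f x
  continuousOn : ContinuousOn f (Ici 0)
  convexOn : ConvexOn ℝ (Ici 0) f
  tendsto_zero : Tendsto f atTop (𝓝 0)
  differentiable₁ : ∀ x, 0 < x → DifferentiableAt ℝ f x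
  differentiable₂ : ∀ x, 0 < x → DifferentiableAt ℝ (deriv f) x
  differentiable₃ : ∀ x, 0 < x → DifferentiableAt ℝ (deriv^[2] f) x

/-- `s` is the abscissa `x_t(x)`: the line through `(x, -f x)` and `(s, f s)` is tangent to the
graph of `f` at `(s, f s)`. -/
def IsTangencyAbscissa (f : ℝ → ℝ) (x s : ℝ) : Prop :=
  0 < s ∧ s < x ∧ (f x + f s) / (x - s) = -deriv f s

/-- `f'' → 0`. -/
def A1 (f : ℝ → ℝ) : Prop := Tendsto (deriv^[2] f) atTop (𝓝 0)

/-- `|f'(x_t)| ≪ |f'(x)|`; for large `x` the abscissa `x_t` exists and is unique. -/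
def A2 (f : ℝ → ℝ) : Prop :=
  ∃ C : ℝ, ∀ᶠ x in atTop, ∀ s, IsTangencyAbscissa f x s → |deriv f s| ≤ C * |deriv f x|

/-- `f f'' / (f')² ≫ 1`. -/
def A3 (f : ℝ → ℝ) : Prop :=
  (fun _ : ℝ => (1 : ℝ)) =O[atTop] fun x => f x * deriv^[2] f x / deriv f x ^ 2

/-- `|f'''| / f'' ≪ 1`; this includes that `f''` is positive everywhere. -/
def A4 (f : ℝ → ℝ) : Prop :=
  (∀ x, 0 < x → 0 < deriv^[2] f x) ∧
    (fun x => |deriv^[3] f x| / deriv^[2] f x) =O[atTop] fun _ : ℝ => (1 : ℝ)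

/-! ### The cross-section -/

/-- Arc length along the dispersing wall (the graph of `f`), from `V` to abscissa `x`. -/
def arcLength (f : ℝ → ℝ) (x : ℝ) : ℝ := ∫ t in (0 : ℝ)..x, √(1 + deriv f t ^ 2)

/-- The abscissa of the point of the wall at arc length `r` from `V`. -/
def abscissa (f : ℝ → ℝ) (r : ℝ) : ℝ := Function.invFunOn (arcLength f) (Ici 0) r

/-- Unit tangent `∂/∂r` of the wall at abscissa `x`. -/
def unitTangent (f : ℝ → ℝ) (x : ℝ) : ℝ × ℝ := (√(1 + deriv f x ^ 2))⁻¹ • (1, deriv f x)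

/-- Unit normal of the wall at abscissa `x`, pointing into the table (below the graph). -/
def inwardNormal (f : ℝ → ℝ) (x : ℝ) : ℝ × ℝ := (√(1 + deriv f x ^ 2))⁻¹ • (deriv f x, -1)

/-- The phase space of line elements `(r, φ)`: arc length and angle between `∂/∂r` and the outgoing
velocity. -/
def phaseSpace : Set (ℝ × ℝ) := Ioi 0 ×ˢ Ioo 0 Real.pi

/-- Invariant measure `sin φ dr dφ` on the phase space. -/
def invMeasure : Measure (ℝ × ℝ) :=
  (volume.restrict phaseSpace).withDensity fun ζ => ENNReal.ofReal (Real.sin ζ.2)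

/-! ### The return map

The billiard flow in `Q = {0 ≤ x, 0 ≤ y ≤ f x}`, with elastic reflections at the two semiaxes, is
the image under the folding `(x, y) ↦ (|x|, |y|)` of the motion on straight lines in the four-fold
copy `Q₄ = {|y| ≤ f |x|}`. The return map takes a line element on the wall to the next line element
on the wall. -/

/-- Position of the line element `(r, φ)`. -/
def position (f : ℝ → ℝ) (ζ : ℝ × ℝ) : ℝ × ℝ := (abscissa f ζ.1, f (abscissa f ζ.1))

/-- Unit velocity of the line element `(r, φ)`. -/
def velocity (f : ℝ → ℝ) (ζ : ℝ × ℝ) : ℝ × ℝ :=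
  Real.cos ζ.2 • unitTangent f (abscissa f ζ.1) + Real.sin ζ.2 • inwardNormal f (abscissa f ζ.1)

/-- Free motion in `Q₄`. -/
def ray (f : ℝ → ℝ) (ζ : ℝ × ℝ) (t : ℝ) : ℝ × ℝ := position f ζ + t • velocity f ζ

/-- The boundary of `Q₄`. -/
def boundary₄ (f : ℝ → ℝ) : Set (ℝ × ℝ) := {p | |p.2| = f |p.1|}

/-- Travelling time to the next collision with the boundary of `Q₄`. -/
def flightTime (f : ℝ → ℝ) (ζ : ℝ × ℝ) : ℝ := sInf {t | 0 < t ∧ ray f ζ t ∈ boundary₄ f}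

/-- The next collision point, in `Q₄`. -/
def collisionPoint (f : ℝ → ℝ) (ζ : ℝ × ℝ) : ℝ × ℝ := ray f ζ (flightTime f ζ)

/-- The component along `∂/∂r` of the velocity (folded back to `Q`) at the next collision. It is
not changed by the reflection; it is `±1` if and only if the collision is tangential. -/
def tangentialSpeed (f : ℝ → ℝ) (ζ : ℝ × ℝ) : ℝ :=
  Real.sign (collisionPoint f ζ).1 * (velocity f ζ).1 *
      (unitTangent f |(collisionPoint f ζ).1|).1 +
    Real.sign (collisionPoint f ζ).2 * (velocity f ζ).2 *
      (unitTangent f |(collisionPoint f ζ).1|).2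

/-- The return map; its domain is `phaseSpace \ singPlusSet f`. -/
def returnMap (f : ℝ → ℝ) (ζ : ℝ × ℝ) : ℝ × ℝ :=
  (arcLength f |(collisionPoint f ζ).1|, Real.arccos (tangentialSpeed f ζ))

/-! ### Singularity curves -/

/-- The curves `F^{0+}`, `F^{1+}`, `F^{2+}`.
* `F^{0+} = [0, ∞) × {π}`;
* `F^{1+}`: the next collision is tangential, after a crossing of the vertical semiaxis only;
* `F^{2+}`: after a crossing of the horizontal semiaxis only, the line element ends in the vertex
  or collides tangentially. -/
def singPlus (f : ℝ → ℝ) : Fin 3 → Set (ℝ × ℝ)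
  | 0 => Ici 0 ×ˢ {Real.pi}
  | 1 => {ζ ∈ phaseSpace | (collisionPoint f ζ).1 < 0 ∧ 0 < (collisionPoint f ζ).2 ∧
      |tangentialSpeed f ζ| = 1}
  | 2 => {ζ ∈ phaseSpace | (collisionPoint f ζ).2 < 0 ∧
      ((collisionPoint f ζ).1 = 0 ∨ (0 < (collisionPoint f ζ).1 ∧ |tangentialSpeed f ζ| = 1))}

/-- The curves `F^{i-}`, obtained from `F^{i+}` by time reversal `(r, φ) ↦ (r, π - φ)`. -/
def singMinus (f : ℝ → ℝ) (i : Fin 3) : Set (ℝ × ℝ) :=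
  {ζ | (ζ.1, Real.pi - ζ.2) ∈ singPlus f i}

/-- `F^+ = F^{1+} ∪ F^{2+}`, the discontinuity set of the return map. -/
def singPlusSet (f : ℝ → ℝ) : Set (ℝ × ℝ) := singPlus f 1 ∪ singPlus f 2

/-- `F^- = F^{1-} ∪ F^{2-}`, the discontinuity set of the inverse of the return map. -/
def singMinusSet (f : ℝ → ℝ) : Set (ℝ × ℝ) := singMinus f 1 ∪ singMinus f 2

/-! ### Unstable distance -/

/-- The unstable cone `{dr · dφ ≤ 0}`. -/
def unstableCone : Set (ℝ × ℝ) := {v | v.1 * v.2 ≤ 0}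

/-- The first nested cone at `ζ`: the image of the unstable cone at the preimage `ζ₋₁` of `ζ` under
the derivative at `ζ₋₁` of the return map. -/
def nestedCone (f : ℝ → ℝ) (ζ : ℝ × ℝ) : Set (ℝ × ℝ) :=
  {v | ∃ ζ' ∈ phaseSpace \ singPlusSet f, returnMap f ζ' = ζ ∧
    ∃ u ∈ unstableCone, fderiv ℝ (returnMap f) ζ' u = v}

/-- `γ : [0, 1] → [0, ∞) × [0, π]` is an unstable curve from `ζ` to `w`: inside the phase space,
apart possibly from the end points, differentiable, with velocity in the nested cone wherever this
cone is defined, that is off `F^-`. -/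
structure IsUnstableCurve (f : ℝ → ℝ) (ζ w : ℝ × ℝ) (γ : ℝ → ℝ × ℝ) : Prop where
  source : γ 0 = ζ
  target : γ 1 = w
  continuousOn : ContinuousOn γ (Icc 0 1)
  mem_phaseSpace : ∀ t ∈ Ioo (0 : ℝ) 1, γ t ∈ phaseSpace
  differentiable : ∀ t ∈ Ioo (0 : ℝ) 1, DifferentiableAt ℝ γ t
  deriv_mem : ∀ t ∈ Ioo (0 : ℝ) 1, γ t ∉ singMinusSet f → deriv γ t ∈ nestedCone f (γ t)

/-- Euclidean length of the curve `γ` on `[0, 1]` (`ℝ × ℝ` itself carries the sup norm). -/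
def curveLength (γ : ℝ → ℝ × ℝ) : ℝ≥0∞ :=
  eVariationOn (fun t => WithLp.toLp 2 (γ t)) (Icc 0 1)

/-- Unstable distance between two points (`∞` if no unstable curve joins them). -/
def unstableDist (f : ℝ → ℝ) (ζ w : ℝ × ℝ) : ℝ≥0∞ :=
  ⨅ (γ : ℝ → ℝ × ℝ) (_ : IsUnstableCurve f ζ w γ), curveLength γ

/-- Unstable distance between a point and a set. -/
def unstableInfDist (f : ℝ → ℝ) (ζ : ℝ × ℝ) (A : Set (ℝ × ℝ)) : ℝ≥0∞ :=
  ⨅ w ∈ A, unstableDist f ζ w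

/-- The `ε`-neighbourhood of `A` with respect to the unstable distance. -/
def unstableNhd (f : ℝ → ℝ) (A : Set (ℝ × ℝ)) (ε : ℝ) : Set (ℝ × ℝ) :=
  {ζ ∈ phaseSpace | unstableInfDist f ζ A ≤ ENNReal.ofReal ε}

end

end CuspBilliard

/-!
In the cusp the nested cone at a line element whose angle with the wall is `O(|f'|)` is nearly
horizontal, `|dφ| ≲ |f'| |dr|`, because (A4) bounds both the curvature by `|f'|` and `|f'|` by `f`.
The elements of the singularity curves are of this kind by (A2), hence, by a continuity argument, so
are all elements of a short unstable curve that ends on one of them. Such a curve can run inside the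
singularity set of the inverse map, where the cone says nothing, but that set is itself made of
Lipschitz graphs with constant `O(|f'|)`. So an unstable curve of length `ε` that starts at arc
length `r` changes `φ` by at most `C |f'| ε`.

The curve `F^{i+}` is the graph of a monotone function `G` with values in `[0, π]`, and
`∫ (G (r + ε) - G (r - ε)) dr ≤ 2 π ε`. The `ε`-neighbourhood of `F^{i+}` lies between the graphs of
`G (r - ε) - C |f'| ε` and `G (r + ε) + C |f'| ε`, and `∫ |f'| < ∞`. Time reversal transfers this to
`F^{i-}`. The curves have infinite length because they reach over every large abscissa.
-/

namespace CuspBilliard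

/-! ### The profile -/

section Profile

variable {f : ℝ → ℝ}

theorem monotoneOn_Ici_of_hasDerivAt_nonneg {g g' : ℝ → ℝ} {X : ℝ}
    (hg : ∀ x, X ≤ x → HasDerivAt g (g' x) x) (hg' : ∀ x, X ≤ x → 0 ≤ g' x) :
    MonotoneOn g (Ici X) := by
  refine monotoneOn_of_hasDerivWithinAt_nonneg (f' := g') (convex_Ici X)
    (fun x hx => (hg x hx).continuousAt.continuousWithinAt) (fun x hx => ?_) fun x hx => ?_
  all_goals rw [interior_Ici] at hx
  · exact (hg x (le_of_lt hx)).hasDerivWithinAt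
  · exact hg' x (le_of_lt hx)

namespace IsProfile

theorem hasDerivAt (hf : IsProfile f) {x : ℝ} (hx : 0 < x) : HasDerivAt f (deriv f x) x :=
  (hf.differentiable₁ x hx).hasDerivAt

theorem hasDerivAt_deriv (hf : IsProfile f) {x : ℝ} (hx : 0 < x) :
    HasDerivAt (deriv f) (deriv (deriv f) x) x :=
  (hf.differentiable₂ x hx).hasDerivAt

theorem hasDerivAt_deriv_deriv (hf : IsProfile f) {x : ℝ} (hx : 0 < x) :
    HasDerivAt (deriv (deriv f)) (deriv (deriv (deriv f)) x) x :=
  (hf.differentiable₃ x hx).hasDerivAt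

theorem tangent_le (hf : IsProfile f) {x y : ℝ} (hx : 0 < x) (hy : 0 ≤ y) :
    f x + deriv f x * (y - x) ≤ f y := by
  rcases lt_trichotomy x y with h | rfl | h
  · have := hf.convexOn.deriv_le_slope (mem_Ici.2 hx.le) (mem_Ici.2 hy) h
      (hf.differentiable₁ x hx)
    rw [slope_def_field, le_div_iff₀ (by linarith)] at this
    linarith
  · simp
  · have := hf.convexOn.slope_le_deriv (mem_Ici.2 hy) (mem_Ici.2 hx.le) h
      (hf.differentiable₁ x hx)
    rw [slope_def_field, div_le_iff₀ (by linarith)] at this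
    linarith

theorem monotoneOn_deriv (hf : IsProfile f) : MonotoneOn (deriv f) (Ioi 0) := by
  intro x hx y hy hxy
  rcases hxy.eq_or_lt with rfl | hxy
  · rfl
  · have h₁ := hf.tangent_le hx (le_of_lt hy)
    have h₂ := hf.tangent_le hy (le_of_lt hx)
    nlinarith

theorem deriv_deriv_nonneg (hf : IsProfile f) {x : ℝ} (hx : 0 < x) : 0 ≤ deriv (deriv f) x := by
  rw [← derivWithin_of_isOpen isOpen_Ioi hx]
  exact hf.monotoneOn_deriv.derivWithin_nonneg

theorem deriv_neg (hf : IsProfile f) {x : ℝ} (hx : 0 < x) : deriv f x < 0 := by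
  by_contra! h
  refine (hf.pos x hx.le).not_ge (ge_of_tendsto hf.tendsto_zero ?_)
  filter_upwards [eventually_ge_atTop x] with y hy
  have := hf.tangent_le hx (hx.le.trans hy)
  nlinarith

theorem strictAntiOn (hf : IsProfile f) : StrictAntiOn f (Ici 0) := by
  refine strictAntiOn_of_deriv_neg (convex_Ici 0) hf.continuousOn fun x hx => ?_
  rw [interior_Ici] at hx
  exact hf.deriv_neg hx

theorem le_of_le (hf : IsProfile f) {x y : ℝ} (hx : 0 ≤ x) (hxy : x ≤ y) : f y ≤ f x :=
  hf.strictAntiOn.antitoneOn hx (hx.trans hxy) hxy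

theorem continuous_comp_abs (hf : IsProfile f) : Continuous fun x : ℝ => f |x| :=
  hf.continuousOn.comp_continuous continuous_abs fun x => mem_Ici.2 (abs_nonneg x)

theorem tendsto_deriv (hf : IsProfile f) : Tendsto (deriv f) atTop (𝓝 0) := by
  have hdiff : Tendsto (fun x : ℝ => f x - f (x - 1)) atTop (𝓝 0) := by
    simpa [Function.comp_def, sub_eq_add_neg] using hf.tendsto_zero.sub
      (hf.tendsto_zero.comp (tendsto_atTop_add_const_right atTop (-1 : ℝ) tendsto_id))
  refine tendsto_of_tendsto_of_tendsto_of_le_of_le' hdiff tendsto_const_nhds ?_ ?_ <;>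
    filter_upwards [eventually_ge_atTop (1 : ℝ)] with x hx
  · have := hf.tangent_le (x := x) (y := x - 1) (by linarith) (by linarith)
    linarith
  · exact (hf.deriv_neg (by linarith)).le

theorem deriv_deriv_le_mul_neg_deriv (hf : IsProfile f) {K X : ℝ} (hK : 0 ≤ K) (hX : 0 < X)
    (h : ∀ x, X ≤ x → -(K * deriv (deriv f) x) ≤ deriv (deriv (deriv f)) x) {x : ℝ}
    (hx : X ≤ x) : deriv (deriv f) x ≤ K * -deriv f x := by
  have hpos : ∀ y, X ≤ y → 0 < y := fun y hy => hX.trans_le hy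
  have hmono : MonotoneOn (fun x => deriv (deriv f) x + K * deriv f x) (Ici X) :=
    monotoneOn_Ici_of_hasDerivAt_nonneg
      (fun y hy => (hf.hasDerivAt_deriv_deriv (hpos y hy)).add
        ((hf.hasDerivAt_deriv (hpos y hy)).const_mul K))
      fun y hy => by linarith [h y hy]
  by_contra! hlt
  -- otherwise `f''` stays above a positive constant beyond `x`, and `f'` becomes positive
  set c := deriv (deriv f) x + K * deriv f x
  have hc0 : 0 < c := by linarith
  have hle : ∀ y, x ≤ y → 0 ≤ deriv (deriv f) y - c := fun y hy => by
    have h₁ := hmono hx (hx.trans hy) hy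
    have h₂ := mul_nonneg hK (neg_nonneg.2 (hf.deriv_neg (hpos y (hx.trans hy))).le)
    simp only at h₁
    linarith
  have hlin : MonotoneOn (fun y => deriv f y - c * y) (Ici x) :=
    monotoneOn_Ici_of_hasDerivAt_nonneg
      (fun y hy => ((hf.hasDerivAt_deriv (hpos y (hx.trans hy))).sub
        ((hasDerivAt_id y).const_mul c)).congr_deriv (by rw [mul_one])) hle
  have hxy : x ≤ x - deriv f x / c := by
    have := div_neg_of_neg_of_pos (hf.deriv_neg (hpos x hx)) hc0
    linarith
  have h₁ := hlin self_mem_Ici hxy hxy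
  have h₂ := hf.deriv_neg (hpos _ (hx.trans hxy))
  have h₃ : c * (x - deriv f x / c) = c * x - deriv f x := by field_simp
  simp only at h₁
  linarith

theorem neg_deriv_le_mul (hf : IsProfile f) {K X : ℝ} (hX : 0 < X)
    (h : ∀ x, X ≤ x → deriv (deriv f) x ≤ K * -deriv f x) {x : ℝ} (hx : X ≤ x) :
    -deriv f x ≤ K * f x := by
  have hmono : MonotoneOn (fun x => -(deriv f x + K * f x)) (Ici X) :=
    monotoneOn_Ici_of_hasDerivAt_nonneg
      (fun y hy => ((hf.hasDerivAt_deriv (hX.trans_le hy)).add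
        ((hf.hasDerivAt (hX.trans_le hy)).const_mul K)).neg)
      fun y hy => by linarith [h y hy]
  have hlim : Tendsto (fun x => -(deriv f x + K * f x)) atTop (𝓝 0) := by
    simpa using (hf.tendsto_deriv.add (hf.tendsto_zero.const_mul K)).neg
  have : -(deriv f x + K * f x) ≤ 0 := ge_of_tendsto hlim <| by
    filter_upwards [eventually_ge_atTop x] with y hy using hmono hx (hx.trans hy) hy
  linarith

theorem neg_deriv_le_exp_mul (hf : IsProfile f) {K X : ℝ} (hX : 0 < X)
    (h : ∀ x, X ≤ x → deriv (deriv f) x ≤ K * -deriv f x) {x y : ℝ} (hx : X ≤ x)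
    (hxy : x ≤ y) : -deriv f x ≤ Real.exp (K * (y - x)) * -deriv f y := by
  have hmono : MonotoneOn (fun x => Real.exp (K * x) * -deriv f x) (Ici X) :=
    monotoneOn_Ici_of_hasDerivAt_nonneg
      (fun y hy => ((hasDerivAt_id y).const_mul K).exp.mul
        (hf.hasDerivAt_deriv (hX.trans_le hy)).neg)
      fun y hy => by
        have := mul_nonneg (Real.exp_pos (K * y)).le (sub_nonneg.2 (h y hy))
        simp only [id_eq, mul_one]
        linarith
  have hle := hmono hx (hx.trans hxy) hxy
  simp only at hle
  rw [mul_sub, Real.exp_sub, div_mul_eq_mul_div, le_div_iff₀ (Real.exp_pos _)]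
  linarith

end IsProfile

theorem A4.exists_bounds (h₄ : A4 f) (hf : IsProfile f) :
    ∃ K X : ℝ, 1 ≤ K ∧ 1 ≤ X ∧ ∀ x, X ≤ x →
      deriv (deriv f) x ≤ K * -deriv f x ∧ -deriv f x ≤ K * f x := by
  obtain ⟨hpos, hbig⟩ := h₄
  obtain ⟨C, hC⟩ := hbig.bound
  obtain ⟨X₀, hX₀⟩ := eventually_atTop.1 hC
  have hX : 0 < max X₀ 1 := lt_max_of_lt_right one_pos
  have hthird : ∀ x, max X₀ 1 ≤ x →
      -(max C 1 * deriv (deriv f) x) ≤ deriv (deriv (deriv f)) x := by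
    intro x hx
    have hp : 0 < deriv (deriv f) x := hpos x (hX.trans_le hx)
    have hle : |deriv (deriv (deriv f)) x| / deriv (deriv f) x ≤ C := by
      have := hX₀ x ((le_max_left _ _).trans hx)
      rw [norm_one, mul_one] at this
      exact (le_abs_self _).trans this
    rw [div_le_iff₀ hp] at hle
    have := mul_le_mul_of_nonneg_right (le_max_left C 1) hp.le
    linarith [neg_abs_le (deriv (deriv (deriv f)) x)]
  have hsecond := fun x (hx : max X₀ 1 ≤ x) =>
    hf.deriv_deriv_le_mul_neg_deriv (le_max_of_le_right zero_le_one) hX hthird hx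
  exact ⟨max C 1, max X₀ 1, le_max_right _ _, le_max_right _ _, fun x hx =>
    ⟨hsecond x hx, hf.neg_deriv_le_mul hX hsecond hx⟩⟩

theorem A4.strictConvexOn (h₄ : A4 f) (hf : IsProfile f) : StrictConvexOn ℝ (Ici 0) f :=
  strictConvexOn_of_deriv2_pos (convex_Ici 0) hf.continuousOn fun x hx =>
    h₄.1 x (by rwa [interior_Ici] at hx)

end Profile

/-! ### Arc length -/

section ArcLength

variable {f : ℝ → ℝ}

theorem measurable_speed : Measurable fun t => √(1 + deriv f t ^ 2) :=
  (((measurable_deriv f).pow_const 2).const_add 1).sqrt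

theorem one_le_speed (x : ℝ) : 1 ≤ √(1 + deriv f x ^ 2) :=
  Real.one_le_sqrt.2 (by nlinarith [sq_nonneg (deriv f x)])

theorem arcLength_zero : arcLength f 0 = 0 := by simp [arcLength]

namespace IsProfile

theorem intervalIntegrable_speed (hf : IsProfile f) {x y : ℝ} (hx : 0 ≤ x) (hxy : x ≤ y) :
    IntervalIntegrable (fun t => √(1 + deriv f t ^ 2)) volume x y := by
  -- `f'` is integrable up to the vertex because `f` is continuous there and `f'` has a sign.
  have hderiv : IntervalIntegrable (fun t => 1 + -deriv f t) volume x y := by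
    refine intervalIntegrable_const.add <|
      intervalIntegral.intervalIntegrable_deriv_of_nonneg (g := fun t => -f t) ?_ ?_ ?_
    · rw [uIcc_of_le hxy]
      exact (hf.continuousOn.mono fun z hz => mem_Ici.2 (hx.trans hz.1)).neg
    all_goals
      intro z hz
      rw [min_eq_left hxy] at hz
    · exact (hf.hasDerivAt (hx.trans_lt hz.1)).neg
    · exact neg_nonneg.2 (hf.deriv_neg (hx.trans_lt hz.1)).le
  refine hderiv.mono_fun measurable_speed.aestronglyMeasurable
    ((ae_restrict_iff' measurableSet_uIoc).2 (Eventually.of_forall fun z hz => ?_))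
  rw [uIoc_of_le hxy] at hz
  have hd := hf.deriv_neg (hx.trans_lt hz.1)
  beta_reduce
  rw [Real.norm_of_nonneg (Real.sqrt_nonneg _), Real.norm_of_nonneg (by linarith)]
  exact Real.sqrt_le_iff.2 ⟨by linarith, by nlinarith⟩

theorem sub_le_arcLength_sub (hf : IsProfile f) {x y : ℝ} (hx : 0 ≤ x) (hxy : x ≤ y) :
    y - x ≤ arcLength f y - arcLength f x := by
  unfold arcLength
  rw [intervalIntegral.integral_interval_sub_left
    (hf.intervalIntegrable_speed le_rfl (hx.trans hxy)) (hf.intervalIntegrable_speed le_rfl hx)]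
  simpa using intervalIntegral.integral_mono_on hxy intervalIntegrable_const
    (hf.intervalIntegrable_speed hx hxy) fun t _ => one_le_speed t

theorem arcLength_nonneg (hf : IsProfile f) {x : ℝ} (hx : 0 ≤ x) : 0 ≤ arcLength f x := by
  have := hf.sub_le_arcLength_sub le_rfl hx
  rw [arcLength_zero] at this
  linarith

theorem strictMonoOn_arcLength (hf : IsProfile f) : StrictMonoOn (arcLength f) (Ici 0) := by
  intro x hx y _ hxy
  linarith [hf.sub_le_arcLength_sub hx hxy.le]

theorem arcLength_pos (hf : IsProfile f) {x : ℝ} (hx : 0 < x) : 0 < arcLength f x := by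
  simpa only [arcLength_zero] using hf.strictMonoOn_arcLength self_mem_Ici hx.le hx

theorem continuousOn_arcLength (hf : IsProfile f) {y : ℝ} (hy : 0 ≤ y) :
    ContinuousOn (arcLength f) (Icc 0 y) := by
  rw [← uIcc_of_le hy]
  refine intervalIntegral.continuousOn_primitive_interval ?_
  rw [uIcc_of_le hy]
  exact (intervalIntegrable_iff_integrableOn_Icc_of_le hy).1
    (hf.intervalIntegrable_speed le_rfl hy)

theorem hasDerivAt_arcLength (hf : IsProfile f) {x : ℝ} (hx : 0 < x) :
    HasDerivAt (arcLength f) (√(1 + deriv f x ^ 2)) x :=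
  intervalIntegral.integral_hasDerivAt_right (hf.intervalIntegrable_speed le_rfl hx.le)
    measurable_speed.stronglyMeasurable.stronglyMeasurableAtFilter
    (((hf.hasDerivAt_deriv hx).continuousAt.pow 2).const_add 1).sqrt

theorem exists_arcLength_eq (hf : IsProfile f) {r : ℝ} (hr : 0 ≤ r) :
    ∃ x ∈ Ici (0 : ℝ), arcLength f x = r := by
  have hivt := intermediate_value_Icc hr (hf.continuousOn_arcLength hr)
  have hle := hf.sub_le_arcLength_sub le_rfl hr
  rw [arcLength_zero] at hivt hle
  obtain ⟨x, hx, hxr⟩ := hivt ⟨hr, by linarith⟩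
  exact ⟨x, hx.1, hxr⟩

theorem abscissa_nonneg (hf : IsProfile f) {r : ℝ} (hr : 0 ≤ r) : 0 ≤ abscissa f r :=
  Function.invFunOn_mem (hf.exists_arcLength_eq hr)

theorem arcLength_abscissa (hf : IsProfile f) {r : ℝ} (hr : 0 ≤ r) :
    arcLength f (abscissa f r) = r :=
  Function.invFunOn_eq (hf.exists_arcLength_eq hr)

theorem abscissa_arcLength (hf : IsProfile f) {x : ℝ} (hx : 0 ≤ x) :
    abscissa f (arcLength f x) = x :=
  have h := hf.arcLength_nonneg hx
  hf.strictMonoOn_arcLength.injOn (hf.abscissa_nonneg h) hx (hf.arcLength_abscissa h)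

theorem abscissa_pos (hf : IsProfile f) {r : ℝ} (hr : 0 < r) : 0 < abscissa f r := by
  refine (hf.abscissa_nonneg hr.le).lt_of_ne fun h => hr.ne ?_
  rw [← hf.arcLength_abscissa hr.le, ← h, arcLength_zero]

theorem abscissa_le_abscissa (hf : IsProfile f) {r r' : ℝ} (hr : 0 ≤ r) (hrr' : r ≤ r') :
    abscissa f r ≤ abscissa f r' := by
  rwa [← hf.strictMonoOn_arcLength.le_iff_le (hf.abscissa_nonneg hr)
    (hf.abscissa_nonneg (hr.trans hrr')), hf.arcLength_abscissa hr,
    hf.arcLength_abscissa (hr.trans hrr')]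

theorem abscissa_sub_le (hf : IsProfile f) {r r' : ℝ} (hr : 0 ≤ r) (hrr' : r ≤ r') :
    abscissa f r' - abscissa f r ≤ r' - r := by
  have := hf.sub_le_arcLength_sub (hf.abscissa_nonneg hr) (hf.abscissa_le_abscissa hr hrr')
  rwa [hf.arcLength_abscissa hr, hf.arcLength_abscissa (hr.trans hrr')] at this

theorem abs_abscissa_sub_le (hf : IsProfile f) {r r' : ℝ} (hr : 0 ≤ r) (hr' : 0 ≤ r') :
    |abscissa f r - abscissa f r'| ≤ |r - r'| := by
  wlog h : r' ≤ r generalizing r r'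
  · rw [abs_sub_comm, abs_sub_comm r]
    exact this hr' hr (le_of_not_ge h)
  rw [abs_of_nonneg (sub_nonneg.2 (hf.abscissa_le_abscissa hr' h)), abs_of_nonneg (sub_nonneg.2 h)]
  exact hf.abscissa_sub_le hr' h

theorem continuousAt_abscissa (hf : IsProfile f) {r : ℝ} (hr : 0 < r) :
    ContinuousAt (abscissa f) r := by
  have hlip : LipschitzOnWith 1 (abscissa f) (Ici 0) := LipschitzOnWith.of_dist_le_mul
    fun r hr r' hr' => by simpa [Real.dist_eq] using hf.abs_abscissa_sub_le hr hr'
  exact hlip.continuousOn.continuousAt (Ici_mem_nhds hr)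

theorem hasDerivAt_abscissa (hf : IsProfile f) {r : ℝ} (hr : 0 < r) :
    HasDerivAt (abscissa f) (√(1 + deriv f (abscissa f r) ^ 2))⁻¹ r := by
  refine (hf.hasDerivAt_arcLength (hf.abscissa_pos hr)).of_local_left_inverse
    (hf.continuousAt_abscissa hr) (one_pos.trans_le (one_le_speed _)).ne' ?_
  filter_upwards [lt_mem_nhds hr] with r' hr'
  exact hf.arcLength_abscissa hr'.le

theorem tendsto_abscissa (hf : IsProfile f) : Tendsto (abscissa f) atTop atTop := by
  refine tendsto_atTop.2 fun b => ?_
  filter_upwards [eventually_ge_atTop (arcLength f |b|)] with r hr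
  have := hf.abscissa_le_abscissa (hf.arcLength_nonneg (abs_nonneg b)) hr
  rw [hf.abscissa_arcLength (abs_nonneg b)] at this
  exact (le_abs_self b).trans this

end IsProfile

end ArcLength

/-! ### Directions -/

section Directions

variable {f : ℝ → ℝ}

/-- The angle by which the wall descends at abscissa `x`. -/
noncomputable def wallAngle (f : ℝ → ℝ) (x : ℝ) : ℝ := -Real.arctan (deriv f x)

/-- The direction in which a line element moves, as the clockwise angle from the positive
`x`-axis. -/
noncomputable def direction (f : ℝ → ℝ) (ζ : ℝ × ℝ) : ℝ := ζ.2 + wallAngle f (abscissa f ζ.1)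

theorem cos_wallAngle (x : ℝ) : Real.cos (wallAngle f x) = (√(1 + deriv f x ^ 2))⁻¹ := by
  rw [wallAngle, Real.cos_neg, Real.cos_arctan, one_div]

theorem cos_wallAngle_pos (x : ℝ) : 0 < Real.cos (wallAngle f x) := by
  rw [wallAngle, Real.cos_neg]
  exact Real.cos_arctan_pos _

theorem sin_wallAngle (x : ℝ) :
    Real.sin (wallAngle f x) = -deriv f x * Real.cos (wallAngle f x) := by
  rw [cos_wallAngle, wallAngle, Real.sin_neg, Real.sin_arctan, neg_mul, div_eq_mul_inv]

theorem wallAngle_mem (x : ℝ) : wallAngle f x ∈ Ioo (-(Real.pi / 2)) (Real.pi / 2) := by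
  rw [wallAngle, ← Real.arctan_neg]
  exact Real.arctan_mem_Ioo _

theorem IsProfile.wallAngle_pos (hf : IsProfile f) {x : ℝ} (hx : 0 < x) : 0 < wallAngle f x :=
  neg_pos.2 (Real.arctan_lt_zero.2 (hf.deriv_neg hx))

theorem unitTangent_eq (x : ℝ) :
    unitTangent f x = (Real.cos (wallAngle f x), -Real.sin (wallAngle f x)) := by
  rw [sin_wallAngle, cos_wallAngle, unitTangent]
  ext <;> simp [mul_comm]

theorem inwardNormal_eq (x : ℝ) :
    inwardNormal f x = (-Real.sin (wallAngle f x), -Real.cos (wallAngle f x)) := by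
  rw [sin_wallAngle, cos_wallAngle, inwardNormal]
  ext <;> simp [mul_comm]

theorem velocity_eq (ζ : ℝ × ℝ) :
    velocity f ζ = (Real.cos (direction f ζ), -Real.sin (direction f ζ)) := by
  rw [velocity, unitTangent_eq, inwardNormal_eq, direction, Real.cos_add, Real.sin_add]
  ext
  · simp [sub_eq_add_neg]
  · simp

theorem velocity_sq (ζ : ℝ × ℝ) : (velocity f ζ).1 ^ 2 + (velocity f ζ).2 ^ 2 = 1 := by
  rw [velocity_eq, neg_sq, Real.cos_sq_add_sin_sq]

theorem sin_snd_pos {ζ : ℝ × ℝ} (hζ : ζ ∈ phaseSpace) : 0 < Real.sin ζ.2 :=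
  Real.sin_pos_of_pos_of_lt_pi hζ.2.1 hζ.2.2

theorem sin_snd_eq (ζ : ℝ × ℝ) : Real.sin ζ.2 =
    Real.sin (direction f ζ) * Real.cos (wallAngle f (abscissa f ζ.1)) -
      Real.cos (direction f ζ) * Real.sin (wallAngle f (abscissa f ζ.1)) := by
  rw [← Real.sin_sub, direction, add_sub_cancel_right]

theorem velocity_snd_lt {ζ : ℝ × ℝ} (hζ : ζ ∈ phaseSpace) :
    (velocity f ζ).2 < deriv f (abscissa f ζ.1) * (velocity f ζ).1 := by
  have hsin := sin_snd_pos hζ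
  rw [sin_snd_eq (f := f), sin_wallAngle] at hsin
  rw [velocity_eq]
  have : 0 < (deriv f (abscissa f ζ.1) * Real.cos (direction f ζ) + Real.sin (direction f ζ)) *
      Real.cos (wallAngle f (abscissa f ζ.1)) := by linarith
  linarith [pos_of_mul_pos_left this (cos_wallAngle_pos _).le]

end Directions

/-! ### The next collision -/

section Collision

variable {f : ℝ → ℝ} {ζ : ℝ × ℝ}

theorem ray_fst (ζ : ℝ × ℝ) (t : ℝ) :
    (ray f ζ t).1 = abscissa f ζ.1 + t * (velocity f ζ).1 := rfl

theorem ray_snd (ζ : ℝ × ℝ) (t : ℝ) :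
    (ray f ζ t).2 = f (abscissa f ζ.1) + t * (velocity f ζ).2 := rfl

theorem collisionPoint_fst (ζ : ℝ × ℝ) : (collisionPoint f ζ).1 =
    abscissa f ζ.1 + flightTime f ζ * (velocity f ζ).1 := rfl

theorem collisionPoint_snd (ζ : ℝ × ℝ) : (collisionPoint f ζ).2 =
    f (abscissa f ζ.1) + flightTime f ζ * (velocity f ζ).2 := rfl

theorem mem_boundary₄ {p : ℝ × ℝ} : p ∈ boundary₄ f ↔ |p.2| = f |p.1| := Iff.rfl

theorem continuous_ray (ζ : ℝ × ℝ) : Continuous (ray f ζ) := by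
  unfold ray
  fun_prop

theorem notMem_boundary_of_lt_flightTime {t : ℝ} (ht : 0 < t) (htτ : t < flightTime f ζ) :
    ray f ζ t ∉ boundary₄ f :=
  fun h => (csInf_le ⟨0, fun _ hs => hs.1.le⟩ ⟨ht, h⟩ : flightTime f ζ ≤ t).not_gt htτ

theorem flightTime_eq {τ : ℝ} (hτ : 0 < τ) (hb : ray f ζ τ ∈ boundary₄ f)
    (h : ∀ t, 0 < t → t < τ → |(ray f ζ t).2| < f |(ray f ζ t).1|) : flightTime f ζ = τ := by
  refine le_antisymm (csInf_le ⟨0, fun _ hs => hs.1.le⟩ ⟨hτ, hb⟩)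
    (le_csInf ⟨τ, hτ, hb⟩ fun t ht => ?_)
  by_contra! hlt
  exact (h t ht.1 hlt).ne ht.2

namespace IsProfile

theorem ray_snd_lt (hf : IsProfile f) (hζ : ζ ∈ phaseSpace) {t : ℝ} (ht : 0 < t)
    (h : 0 ≤ (ray f ζ t).1) : (ray f ζ t).2 < f (ray f ζ t).1 := by
  have htangent := hf.tangent_le (hf.abscissa_pos hζ.1) h
  have hslope := mul_lt_mul_of_pos_left (velocity_snd_lt (f := f) hζ) ht
  rw [ray_fst] at htangent
  rw [ray_fst, ray_snd]
  linarith

theorem continuous_gap (hf : IsProfile f) (ζ : ℝ × ℝ) :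
    Continuous fun t => f |(ray f ζ t).1| - |(ray f ζ t).2| :=
  (hf.continuous_comp_abs.comp (continuous_ray ζ).fst).sub (continuous_ray ζ).snd.abs

theorem exists_mem_boundary_of_le (hf : IsProfile f) {s t : ℝ} (hst : s ≤ t)
    (hs : |(ray f ζ s).2| < f |(ray f ζ s).1|) (ht : f |(ray f ζ t).1| ≤ |(ray f ζ t).2|) :
    ∃ t' ∈ Icc s t, ray f ζ t' ∈ boundary₄ f := by
  obtain ⟨t', ht', hgap⟩ := intermediate_value_Icc' hst (hf.continuous_gap ζ).continuousOn
    ⟨sub_nonpos.2 ht, (sub_pos.2 hs).le⟩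
  exact ⟨t', ht', (sub_eq_zero.1 hgap).symm⟩

theorem exists_forall_abs_ray_lt (hf : IsProfile f) (hζ : ζ ∈ phaseSpace) :
    ∃ δ > 0, ∀ t, 0 < t → t < δ → |(ray f ζ t).2| < f |(ray f ζ t).1| := by
  have hx := hf.abscissa_pos hζ.1
  have hquadrant : ∀ᶠ t in 𝓝 (0 : ℝ), 0 < (ray f ζ t).1 ∧ 0 < (ray f ζ t).2 := by
    refine ((continuous_ray ζ).fst.tendsto 0 |>.eventually_const_lt ?_).and
      ((continuous_ray ζ).snd.tendsto 0 |>.eventually_const_lt ?_)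
    · simpa [ray_fst] using hx
    · simpa [ray_snd] using hf.pos _ hx.le
  obtain ⟨δ, hδ, h⟩ := Metric.eventually_nhds_iff.1 hquadrant
  refine ⟨δ, hδ, fun t ht htδ => ?_⟩
  obtain ⟨h₁, h₂⟩ := h (y := t) (by rwa [Real.dist_eq, sub_zero, abs_of_pos ht])
  rw [abs_of_pos h₁, abs_of_pos h₂]
  exact hf.ray_snd_lt hζ ht h₁.le

theorem ray_mem_boundary_of_horizontal (hf : IsProfile f) (hζ : ζ ∈ phaseSpace)
    (hv : (velocity f ζ).2 = 0) : ray f ζ (2 * abscissa f ζ.1) ∈ boundary₄ f := by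
  have hx := hf.abscissa_pos hζ.1
  have hleft : (velocity f ζ).1 = -1 := by
    have hslope := velocity_snd_lt (f := f) hζ
    have hunit := velocity_sq (f := f) ζ
    have hneg := hf.deriv_neg hx
    rw [hv] at hslope hunit
    have : (velocity f ζ).1 < 0 := by
      by_contra! h
      nlinarith
    nlinarith
  have hend : ray f ζ (2 * abscissa f ζ.1) = (-abscissa f ζ.1, f (abscissa f ζ.1)) := by
    ext
    · rw [ray_fst, hleft]; ring
    · rw [ray_snd, hv]; ring
  rw [hend, mem_boundary₄, abs_neg, abs_of_pos hx, abs_of_pos (hf.pos _ hx.le)]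

theorem eventually_le_abs_ray_snd (hf : IsProfile f) (hv : (velocity f ζ).2 ≠ 0) :
    ∀ᶠ t in atTop, f |(ray f ζ t).1| ≤ |(ray f ζ t).2| := by
  have hlim : Tendsto (fun t => t * |(velocity f ζ).2| - |f (abscissa f ζ.1)|) atTop atTop :=
    tendsto_atTop_add_const_right _ _ (tendsto_id.atTop_mul_const (abs_pos.2 hv))
  filter_upwards [hlim.eventually_ge_atTop (f 0), eventually_ge_atTop 0] with t ht ht₀
  have htri := abs_sub_abs_le_abs_sub (t * (velocity f ζ).2) (-f (abscissa f ζ.1))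
  rw [abs_mul, abs_of_nonneg ht₀, abs_neg, sub_neg_eq_add, add_comm (t * _), ← ray_snd] at htri
  exact (hf.le_of_le le_rfl (abs_nonneg _)).trans (ht.trans htri)

theorem exists_mem_boundary (hf : IsProfile f) (hζ : ζ ∈ phaseSpace) :
    ∃ t, 0 < t ∧ ray f ζ t ∈ boundary₄ f := by
  by_cases hv : (velocity f ζ).2 = 0
  · exact ⟨2 * abscissa f ζ.1, by linarith [hf.abscissa_pos hζ.1],
      hf.ray_mem_boundary_of_horizontal hζ hv⟩
  · obtain ⟨δ, hδ, hgap⟩ := hf.exists_forall_abs_ray_lt hζ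
    obtain ⟨T, hT, hδT⟩ :=
      ((hf.eventually_le_abs_ray_snd hv).and (eventually_ge_atTop (δ / 2))).exists
    obtain ⟨t, ht, hb⟩ :=
      hf.exists_mem_boundary_of_le hδT (hgap (δ / 2) (by linarith) (by linarith)) hT
    exact ⟨t, by linarith [ht.1], hb⟩

theorem flightTime_mem (hf : IsProfile f) (hζ : ζ ∈ phaseSpace) :
    flightTime f ζ ∈ {t | 0 < t ∧ ray f ζ t ∈ boundary₄ f} := by
  obtain ⟨δ, hδ, hgap⟩ := hf.exists_forall_abs_ray_lt hζ
  have hset : {t | 0 < t ∧ ray f ζ t ∈ boundary₄ f} =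
      Ici δ ∩ {t | |(ray f ζ t).2| = f |(ray f ζ t).1|} := by
    ext t
    refine ⟨fun ⟨ht, hb⟩ => ⟨?_, hb⟩, fun ⟨ht, hb⟩ => ⟨hδ.trans_le ht, hb⟩⟩
    by_contra h
    exact (hgap t ht (not_le.1 h)).ne hb
  refine IsClosed.csInf_mem ?_ (hf.exists_mem_boundary hζ) ⟨0, fun t ht => ht.1.le⟩
  rw [hset]
  exact isClosed_Ici.inter (isClosed_eq (continuous_ray ζ).snd.abs
    (hf.continuous_comp_abs.comp (continuous_ray ζ).fst))

theorem flightTime_pos (hf : IsProfile f) (hζ : ζ ∈ phaseSpace) : 0 < flightTime f ζ :=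
  (hf.flightTime_mem hζ).1

theorem collisionPoint_mem_boundary (hf : IsProfile f) (hζ : ζ ∈ phaseSpace) :
    |(collisionPoint f ζ).2| = f |(collisionPoint f ζ).1| :=
  (hf.flightTime_mem hζ).2

theorem abs_ray_lt (hf : IsProfile f) (hζ : ζ ∈ phaseSpace) {t : ℝ} (ht : 0 < t)
    (htτ : t < flightTime f ζ) : |(ray f ζ t).2| < f |(ray f ζ t).1| := by
  obtain ⟨δ, hδ, hgap⟩ := hf.exists_forall_abs_ray_lt hζ
  by_contra! hle
  have hδt : δ ≤ t := not_lt.1 fun h => hle.not_gt (hgap t ht h)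
  obtain ⟨s, hs, hb⟩ := hf.exists_mem_boundary_of_le (by linarith)
    (hgap (δ / 2) (by linarith) (by linarith)) hle
  exact notMem_boundary_of_lt_flightTime (by linarith [hs.1]) (hs.2.trans_lt htτ) hb

theorem collisionPoint_neg (hf : IsProfile f) (hζ : ζ ∈ phaseSpace) :
    (collisionPoint f ζ).1 < 0 ∨ (collisionPoint f ζ).2 < 0 := by
  by_contra! h
  have hb := hf.collisionPoint_mem_boundary hζ
  rw [abs_of_nonneg h.1, abs_of_nonneg h.2] at hb
  exact (hf.ray_snd_lt hζ (hf.flightTime_pos hζ) h.1).ne hb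

theorem collisionPoint_snd_ne_zero (hf : IsProfile f) (hζ : ζ ∈ phaseSpace) :
    (collisionPoint f ζ).2 ≠ 0 := by
  rw [← abs_pos, hf.collisionPoint_mem_boundary hζ]
  exact hf.pos _ (abs_nonneg _)

end IsProfile

/-- The signs of the coordinates of the next collision point. -/
noncomputable def quadrant (f : ℝ → ℝ) (ζ : ℝ × ℝ) : ℝ × ℝ :=
  (Real.sign (collisionPoint f ζ).1, Real.sign (collisionPoint f ζ).2)

/-- The three open quadrants in which a collision can happen; the wall from which the line element
starts lies in the fourth. -/
def collisionQuadrants : Set (ℝ × ℝ) := {(-1, 1), (-1, -1), (1, -1)}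

theorem sq_eq_one_of_mem_collisionQuadrants {σ : ℝ × ℝ} (h : σ ∈ collisionQuadrants) :
    σ.1 ^ 2 = 1 ∧ σ.2 ^ 2 = 1 := by
  rcases h with rfl | rfl | rfl <;> norm_num

theorem IsProfile.quadrant_mem (hf : IsProfile f) (hζ : ζ ∈ phaseSpace)
    (h₀ : (collisionPoint f ζ).1 ≠ 0) : quadrant f ζ ∈ collisionQuadrants := by
  have hneg := hf.collisionPoint_neg hζ
  unfold quadrant collisionQuadrants
  rcases h₀.lt_or_gt with h | h <;>
    rcases (hf.collisionPoint_snd_ne_zero hζ).lt_or_gt with h' | h'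
  · simp [Real.sign_of_neg h, Real.sign_of_neg h']
  · simp [Real.sign_of_neg h, Real.sign_of_pos h']
  · simp [Real.sign_of_pos h, Real.sign_of_neg h']
  · exact absurd hneg (not_or.2 ⟨h.not_gt, h'.not_gt⟩)

theorem sign_mul_abs_self (x : ℝ) : Real.sign x * |x| = x := by
  rcases lt_trichotomy x 0 with h | h | h
  · rw [Real.sign_of_neg h, abs_of_neg h, neg_one_mul, neg_neg]
  · rw [h, Real.sign_zero, zero_mul]
  · rw [Real.sign_of_pos h, abs_of_pos h, one_mul]

theorem IsProfile.collisionPoint_eq (hf : IsProfile f) (hζ : ζ ∈ phaseSpace) :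
    collisionPoint f ζ = ((quadrant f ζ).1 * |(collisionPoint f ζ).1|,
      (quadrant f ζ).2 * f |(collisionPoint f ζ).1|) := by
  rw [← hf.collisionPoint_mem_boundary hζ]
  exact Prod.ext (sign_mul_abs_self _).symm (sign_mul_abs_self _).symm

end Collision

/-! ### The derivative of the return map -/

section Cone

variable {f : ℝ → ℝ} {ζ : ℝ × ℝ}

/-- Curvature of the wall at abscissa `x`. -/
noncomputable def curvature (f : ℝ → ℝ) (x : ℝ) : ℝ :=
  deriv (deriv f) x / (1 + deriv f x ^ 2) * (√(1 + deriv f x ^ 2))⁻¹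

/-- The cross product, in `Q₄`, of the unit tangent of the wall at the next collision point with
the velocity: up to the sign, the sine of the angle of incidence. -/
noncomputable def incidence (f : ℝ → ℝ) (ζ : ℝ × ℝ) : ℝ :=
  (quadrant f ζ).2 * Real.cos (direction f ζ) *
      Real.sin (wallAngle f (abscissa f (returnMap f ζ).1)) -
    (quadrant f ζ).1 * Real.sin (direction f ζ) *
      Real.cos (wallAngle f (abscissa f (returnMap f ζ).1))

/-- The point `σ · (x, f x)`, for `x` the abscissa of the next collision, lies on the line of the
motion if and only if this vanishes. -/
noncomputable def lineDefect (f : ℝ → ℝ) (σ ζ : ℝ × ℝ) : ℝ :=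
  (σ.1 * abscissa f (returnMap f ζ).1 - abscissa f ζ.1) * (velocity f ζ).2 -
    (σ.2 * f (abscissa f (returnMap f ζ).1) - f (abscissa f ζ.1)) * (velocity f ζ).1

theorem isOpen_phaseSpace : IsOpen phaseSpace := isOpen_Ioi.prod isOpen_Ioo

theorem tangentialSpeed_eq (ζ : ℝ × ℝ) : tangentialSpeed f ζ =
    (quadrant f ζ).1 * Real.cos (direction f ζ) *
        Real.cos (wallAngle f |(collisionPoint f ζ).1|) +
      (quadrant f ζ).2 * Real.sin (direction f ζ) *
        Real.sin (wallAngle f |(collisionPoint f ζ).1|) := by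
  rw [tangentialSpeed, velocity_eq, unitTangent_eq, quadrant]
  ring

theorem abs_tangentialSpeed_le_one (ζ : ℝ × ℝ) : |tangentialSpeed f ζ| ≤ 1 := by
  have hsign : ∀ x : ℝ, Real.sign x ^ 2 ≤ 1 := fun x => by
    rcases Real.sign_apply_eq x with h | h | h <;> rw [h] <;> norm_num
  have hσ₁ : (quadrant f ζ).1 ^ 2 ≤ 1 := hsign _
  have hσ₂ : (quadrant f ζ).2 ^ 2 ≤ 1 := hsign _
  rw [tangentialSpeed_eq, ← sq_le_one_iff_abs_le_one]
  generalize wallAngle f |(collisionPoint f ζ).1| = α, direction f ζ = Θ,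
    (quadrant f ζ).1 = σ₁, (quadrant f ζ).2 = σ₂ at *
  have hle : (σ₁ * Real.cos Θ) ^ 2 + (σ₂ * Real.sin Θ) ^ 2 ≤ 1 := by
    nlinarith [Real.sin_sq_add_cos_sq Θ, sq_nonneg (Real.cos Θ), sq_nonneg (Real.sin Θ)]
  nlinarith [Real.sin_sq_add_cos_sq α,
    sq_nonneg (σ₁ * Real.cos Θ * Real.sin α - σ₂ * Real.sin Θ * Real.cos α)]

theorem cos_returnMap (ζ : ℝ × ℝ) : Real.cos (returnMap f ζ).2 = tangentialSpeed f ζ := by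
  have := abs_le.1 (abs_tangentialSpeed_le_one (f := f) ζ)
  exact Real.cos_arccos this.1 this.2

theorem collisionPoint_fst_ne_zero (h : 0 < (returnMap f ζ).1) :
    (collisionPoint f ζ).1 ≠ 0 := by
  intro h0
  simp [returnMap, h0, arcLength_zero] at h

namespace IsProfile

theorem curvature_nonneg (hf : IsProfile f) {x : ℝ} (hx : 0 < x) : 0 ≤ curvature f x := by
  have := hf.deriv_deriv_nonneg hx
  unfold curvature
  positivity

theorem curvature_le (hf : IsProfile f) {x : ℝ} (hx : 0 < x) :
    curvature f x ≤ deriv (deriv f) x := by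
  have hconvex := hf.deriv_deriv_nonneg hx
  have hdiv : deriv (deriv f) x / (1 + deriv f x ^ 2) ≤ deriv (deriv f) x :=
    div_le_self hconvex (by nlinarith [sq_nonneg (deriv f x)])
  exact (mul_le_of_le_one_right (by positivity) (inv_le_one_of_one_le₀ (one_le_speed x))).trans
    hdiv

theorem hasDerivAt_wallAngle_abscissa (hf : IsProfile f) {r : ℝ} (hr : 0 < r) :
    HasDerivAt (fun r => wallAngle f (abscissa f r)) (-curvature f (abscissa f r)) r := by
  refine ((hf.hasDerivAt_deriv (hf.abscissa_pos hr)).comp r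
    (hf.hasDerivAt_abscissa hr)).arctan.neg.congr_deriv ?_
  simp only [curvature, Function.comp]
  ring

theorem hasDerivAt_height (hf : IsProfile f) {r : ℝ} (hr : 0 < r) :
    HasDerivAt (fun r => f (abscissa f r)) (-Real.sin (wallAngle f (abscissa f r))) r := by
  refine ((hf.hasDerivAt (hf.abscissa_pos hr)).comp r
    (hf.hasDerivAt_abscissa hr)).congr_deriv ?_
  rw [sin_wallAngle, cos_wallAngle]
  ring

theorem abscissa_returnMap (hf : IsProfile f) (ζ : ℝ × ℝ) :
    abscissa f (returnMap f ζ).1 = |(collisionPoint f ζ).1| :=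
  hf.abscissa_arcLength (abs_nonneg _)

theorem cos_returnMap_eq (hf : IsProfile f) (ζ : ℝ × ℝ) : Real.cos (returnMap f ζ).2 =
    (quadrant f ζ).1 * Real.cos (direction f ζ) *
        Real.cos (wallAngle f (abscissa f (returnMap f ζ).1)) +
      (quadrant f ζ).2 * Real.sin (direction f ζ) *
        Real.sin (wallAngle f (abscissa f (returnMap f ζ).1)) := by
  rw [cos_returnMap, tangentialSpeed_eq, hf.abscissa_returnMap]

theorem incidence_sq (hf : IsProfile f) (hζ : ζ ∈ phaseSpace) (h₀ : (collisionPoint f ζ).1 ≠ 0) :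
    incidence f ζ ^ 2 = Real.sin (returnMap f ζ).2 ^ 2 := by
  obtain ⟨hσ₁, hσ₂⟩ := sq_eq_one_of_mem_collisionQuadrants (hf.quadrant_mem hζ h₀)
  rw [Real.sin_sq, hf.cos_returnMap_eq, incidence]
  generalize wallAngle f (abscissa f (returnMap f ζ).1) = α
  have hα := Real.sin_sq_add_cos_sq α
  have hΘ := Real.sin_sq_add_cos_sq (direction f ζ)
  linear_combination (Real.cos (direction f ζ) ^ 2 * Real.cos α ^ 2 +
      Real.cos α ^ 2 * Real.sin (direction f ζ) ^ 2) * hσ₁ +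
    (Real.sin α ^ 2 * Real.cos (direction f ζ) ^ 2 +
      Real.sin (direction f ζ) ^ 2 * Real.sin α ^ 2) * hσ₂ +
    (Real.cos α ^ 2 + Real.sin α ^ 2) * hΘ + hα

theorem lineDefect_quadrant (hf : IsProfile f) (hζ : ζ ∈ phaseSpace) :
    lineDefect f (quadrant f ζ) ζ = 0 := by
  obtain ⟨h₁, h₂⟩ := Prod.ext_iff.1 (hf.collisionPoint_eq hζ)
  dsimp only at h₁ h₂
  rw [lineDefect, hf.abscissa_returnMap, ← h₁, ← h₂, collisionPoint_fst, collisionPoint_snd]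
  ring

theorem eq_of_lineDefect_eq_zero (hf : IsProfile f) (hζ : ζ ∈ phaseSpace)
    (hT : 0 < (returnMap f ζ).1) {σ σ' : ℝ × ℝ} (hσ : σ ∈ collisionQuadrants)
    (hσ' : σ' ∈ collisionQuadrants) (h : lineDefect f σ ζ = 0) (h' : lineDefect f σ' ζ = 0) :
    σ = σ' := by
  have hv := velocity_sq (f := f) ζ
  have hx := hf.abscissa_pos hζ.1
  have hy := hf.pos _ hx.le
  have hX := hf.abscissa_pos hT
  have hY := hf.pos _ hX.le
  unfold lineDefect at h h'
  generalize (velocity f ζ).1 = v, (velocity f ζ).2 = w, f (abscissa f ζ.1) = y,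
    f (abscissa f (returnMap f ζ).1) = Y at *
  generalize abscissa f ζ.1 = x, abscissa f (returnMap f ζ).1 = X at *
  have hcollinear : (σ.1 * X - x) * (σ'.2 * Y - y) - (σ.2 * Y - y) * (σ'.1 * X - x) = 0 := by
    linear_combination (-((σ.1 * X - x) * (σ'.2 * Y - y) - (σ.2 * Y - y) * (σ'.1 * X - x))) * hv
      + (v * (σ'.1 * X - x) + w * (σ'.2 * Y - y)) * h
      - (v * (σ.1 * X - x) + w * (σ.2 * Y - y)) * h'
  rcases hσ with rfl | rfl | rfl <;> rcases hσ' with rfl | rfl | rfl <;> first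
    | rfl
    | (exfalso; simp only at hcollinear; nlinarith [mul_pos hX hY, mul_pos hx hY, mul_pos hX hy])

theorem continuousAt_velocity (hf : IsProfile f) (hζ : ζ ∈ phaseSpace) :
    ContinuousAt (velocity f) ζ := by
  have hdirection : ContinuousAt (direction f) ζ := continuousAt_snd.add <|
    ContinuousAt.comp' (f := Prod.fst) (hf.hasDerivAt_wallAngle_abscissa hζ.1).continuousAt
      continuousAt_fst
  rw [show velocity f = _ from funext velocity_eq]
  exact (Real.continuous_cos.continuousAt.comp' hdirection).prodMk
    (Real.continuous_sin.continuousAt.comp' hdirection).neg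

theorem continuousAt_lineDefect (hf : IsProfile f) (hζ : ζ ∈ phaseSpace)
    (hT : 0 < (returnMap f ζ).1) (hc : ContinuousAt (returnMap f) ζ) (σ : ℝ × ℝ) :
    ContinuousAt (lineDefect f σ) ζ := by
  have habscissa : ∀ {g : ℝ × ℝ → ℝ}, 0 < g ζ → ContinuousAt g ζ →
      ContinuousAt (fun z => abscissa f (g z)) ζ := fun h hg =>
    ContinuousAt.comp' (hf.continuousAt_abscissa h) hg
  have hheight : ∀ {g : ℝ × ℝ → ℝ}, 0 < g ζ → ContinuousAt g ζ →
      ContinuousAt (fun z => f (abscissa f (g z))) ζ := fun h hg =>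
    ContinuousAt.comp' (g := fun r => f (abscissa f r)) (hf.hasDerivAt_height h).continuousAt hg
  have hv := hf.continuousAt_velocity hζ
  exact ((((habscissa hT hc.fst).const_mul σ.1).sub (habscissa hζ.1 continuousAt_fst)).mul
    hv.snd).sub
    ((((hheight hT hc.fst).const_mul σ.2).sub (hheight hζ.1 continuousAt_fst)).mul hv.fst)

theorem eventually_quadrant_eq (hf : IsProfile f) (hζ : ζ ∈ phaseSpace)
    (hT : 0 < (returnMap f ζ).1) (hc : ContinuousAt (returnMap f) ζ) :
    ∀ᶠ z in 𝓝 ζ, z ∈ phaseSpace ∧ quadrant f z = quadrant f ζ := by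
  have hσ := hf.quadrant_mem hζ (collisionPoint_fst_ne_zero hT)
  have hdefect : ∀ᶠ z in 𝓝 ζ, ∀ σ ∈ collisionQuadrants, lineDefect f σ z = 0 →
      σ = quadrant f ζ := by
    refine (Set.Finite.eventually_all (by unfold collisionQuadrants; exact toFinite _)).2
      fun σ hσ' => ?_
    by_cases h : σ = quadrant f ζ
    · exact Eventually.of_forall fun _ _ => h
    · filter_upwards [(hf.continuousAt_lineDefect hζ hT hc σ).eventually_ne fun h₀ => h
        (hf.eq_of_lineDefect_eq_zero hζ hT hσ' hσ h₀ (hf.lineDefect_quadrant hζ))] with z hz h₀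
      exact absurd h₀ hz
  filter_upwards [isOpen_phaseSpace.mem_nhds hζ, hc.fst.eventually_const_lt hT, hdefect]
    with z hz hzT hzσ
  exact ⟨hz, hzσ _ (hf.quadrant_mem hz (collisionPoint_fst_ne_zero hzT))
    (hf.lineDefect_quadrant hz)⟩

end IsProfile

section Jacobi

variable {z : ℝ → ℝ × ℝ} {u v : ℝ × ℝ} {s : ℝ}

theorem IsProfile.hasDerivAt_direction (hf : IsProfile f) (hr : 0 < (z s).1)
    (hz : HasDerivAt z u s) : HasDerivAt (fun t => direction f (z t))
      (u.2 - curvature f (abscissa f (z s).1) * u.1) s := by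
  have hφ : HasDerivAt (fun t => (z t).2) u.2 s := hz.snd
  refine (hφ.add ((hf.hasDerivAt_wallAngle_abscissa hr).comp s hz.fst)).congr_deriv ?_
  ring

theorem IsProfile.deriv_mul_incidence (hf : IsProfile f) (hζ : z s ∈ phaseSpace)
    (hT : 0 < (returnMap f (z s)).1) (hz : HasDerivAt z u s)
    (hv : HasDerivAt (fun t => returnMap f (z t)) v s)
    (hσ : ∀ᶠ t in 𝓝 s, z t ∈ phaseSpace ∧ quadrant f (z t) = quadrant f (z s)) :
    v.1 * incidence f (z s) = flightTime f (z s) *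
      (u.2 - curvature f (abscissa f (z s).1) * u.1) - Real.sin (z s).2 * u.1 := by
  have hΘ := hf.hasDerivAt_direction hζ.1 hz
  have hx := (hf.hasDerivAt_abscissa hζ.1).comp s hz.fst
  have hy := (hf.hasDerivAt_height hζ.1).comp s hz.fst
  have hX := (hf.hasDerivAt_abscissa hT).comp s hv.fst
  have hY := (hf.hasDerivAt_height hT).comp s hv.fst
  have hdefect : (fun t => lineDefect f (quadrant f (z s)) (z t)) =ᶠ[𝓝 s] fun _ => 0 := by
    filter_upwards [hσ] with t ht
    rw [← ht.2]
    exact hf.lineDefect_quadrant ht.1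
  have hderiv := ((((hX.const_mul (quadrant f (z s)).1).sub hx).mul hΘ.sin.neg).sub
    (((hY.const_mul (quadrant f (z s)).2).sub hy).mul hΘ.cos)).unique
    ((hasDerivAt_const s (0 : ℝ)).congr_of_eventuallyEq (by
      filter_upwards [hdefect] with t ht
      simp only [lineDefect, velocity_eq] at ht
      exact ht))
  have hcollision := Prod.ext_iff.1 (hf.collisionPoint_eq hζ)
  rw [← hf.abscissa_returnMap, collisionPoint_fst, collisionPoint_snd, velocity_eq] at hcollision
  have hunit := Real.sin_sq_add_cos_sq (direction f (z s))
  have hsin := sin_snd_eq (f := f) (z s)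
  simp only [Function.comp, Pi.sub_apply, Pi.neg_apply, ← cos_wallAngle] at hderiv
  simp only at hcollision
  rw [incidence]
  linear_combination hderiv
    - Real.cos (direction f (z s)) * (u.2 - curvature f (abscissa f (z s).1) * u.1) * hcollision.1
    + Real.sin (direction f (z s)) * (u.2 - curvature f (abscissa f (z s).1) * u.1) * hcollision.2
    + flightTime f (z s) * (u.2 - curvature f (abscissa f (z s).1) * u.1) * hunit + u.1 * hsin

theorem IsProfile.sin_returnMap_mul_deriv (hf : IsProfile f) (hζ : z s ∈ phaseSpace)
    (hT : 0 < (returnMap f (z s)).1) (hz : HasDerivAt z u s)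
    (hv : HasDerivAt (fun t => returnMap f (z t)) v s)
    (hσ : ∀ᶠ t in 𝓝 s, z t ∈ phaseSpace ∧ quadrant f (z t) = quadrant f (z s)) :
    Real.sin (returnMap f (z s)).2 * v.2 = -(incidence f (z s) *
      (u.2 - curvature f (abscissa f (z s).1) * u.1 + (quadrant f (z s)).1 * (quadrant f (z s)).2 *
        curvature f (abscissa f (returnMap f (z s)).1) * v.1)) := by
  obtain ⟨hσ₁, hσ₂⟩ := sq_eq_one_of_mem_collisionQuadrants
    (hf.quadrant_mem hζ (collisionPoint_fst_ne_zero hT))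
  have hΘ := hf.hasDerivAt_direction hζ.1 hz
  have hα := (hf.hasDerivAt_wallAngle_abscissa hT).comp s hv.fst
  have hφ : HasDerivAt (fun t => (returnMap f (z t)).2) v.2 s := hv.snd
  have hderiv := hφ.cos.unique
    ((((hΘ.cos.const_mul (quadrant f (z s)).1).mul hα.cos).add
      ((hΘ.sin.const_mul (quadrant f (z s)).2).mul hα.sin)).congr_of_eventuallyEq (by
        filter_upwards [hσ] with t ht
        rw [hf.cos_returnMap_eq, ht.2]
        rfl))
  simp only [Function.comp] at hderiv
  rw [incidence]
  generalize wallAngle f (abscissa f (returnMap f (z s)).1) = α at *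
  linear_combination -hderiv
    - (quadrant f (z s)).2 * Real.cos α * Real.sin (direction f (z s)) *
      curvature f (abscissa f (returnMap f (z s)).1) * v.1 * hσ₁
    + (quadrant f (z s)).1 * Real.sin α * Real.cos (direction f (z s)) *
      curvature f (abscissa f (returnMap f (z s)).1) * v.1 * hσ₂

end Jacobi

theorem abs_le_of_diverging {v₁ v₂ q τ θ s a S σ k : ℝ} (hS : 0 < S) (hτ : 0 < τ) (hs : 0 ≤ s)
    (hk : 0 ≤ k) (hq : q ^ 2 = S ^ 2) (hσ : σ ^ 2 = 1) (ha : a * θ ≤ 0)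
    (h₁ : v₁ * q = τ * θ - s * a) (h₂ : S * v₂ = -(q * (θ + σ * k * v₁))) :
    |v₂| ≤ (k + S / τ) * |v₁| := by
  have hq' : |q| = S := by rw [← abs_of_pos hS]; exact (sq_eq_sq_iff_abs_eq_abs q S).1 hq
  have hσ' : |σ| = 1 := by rw [← abs_one]; exact (sq_eq_sq_iff_abs_eq_abs σ 1).1 (by simpa using hσ)
  have hv₂ : |v₂| ≤ |θ| + k * |v₁| := by
    have := congrArg abs h₂
    rw [abs_neg, abs_mul, abs_mul, hq', abs_of_pos hS] at this
    rw [mul_left_cancel₀ hS.ne' this]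
    simpa [abs_mul, hσ', abs_of_nonneg hk] using abs_add_le θ (σ * k * v₁)
  -- `a` and `θ` have opposite signs, so nothing cancels in `h₁`
  have hθ : τ * |θ| ≤ S * |v₁| := by
    have : |τ * θ| ≤ |τ * θ - s * a| := by
      apply sq_le_sq.1
      nlinarith [sq_nonneg (s * a), mul_nonneg (mul_nonneg hs hτ.le) (neg_nonneg.2 ha)]
    rwa [← h₁, abs_mul, abs_mul, hq', abs_of_pos hτ, mul_comm |v₁|] at this
  rw [mul_comm τ, ← le_div_iff₀ hτ, ← div_mul_eq_mul_div] at hθ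
  linarith

theorem IsProfile.abs_fderiv_returnMap_snd_le (hf : IsProfile f) (hζ : ζ ∈ phaseSpace)
    (hT : returnMap f ζ ∈ phaseSpace) {u : ℝ × ℝ} (hu : u ∈ unstableCone) :
    |(fderiv ℝ (returnMap f) ζ u).2| ≤
      (curvature f (abscissa f (returnMap f ζ).1) +
        Real.sin (returnMap f ζ).2 / flightTime f ζ) * |(fderiv ℝ (returnMap f) ζ u).1| := by
  by_cases hd : DifferentiableAt ℝ (returnMap f) ζ
  swap
  · simp [fderiv_zero_of_not_differentiableAt hd]
  obtain ⟨z, hz₀, hz⟩ : ∃ z : ℝ → ℝ × ℝ, z 0 = ζ ∧ HasDerivAt z u 0 :=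
    ⟨fun s => ζ + s • u, by simp, by
      simpa using ((hasDerivAt_id (0 : ℝ)).smul_const u).const_add ζ⟩
  subst hz₀
  have hv := hd.hasFDerivAt.comp_hasDerivAt 0 hz
  have hσ := hz.continuousAt.tendsto.eventually
    (hf.eventually_quadrant_eq hζ hT.1 hd.continuousAt)
  have h₀ := collisionPoint_fst_ne_zero hT.1
  obtain ⟨hσ₁, hσ₂⟩ := sq_eq_one_of_mem_collisionQuadrants (hf.quadrant_mem hζ h₀)
  refine abs_le_of_diverging (sin_snd_pos hT) (hf.flightTime_pos hζ) (sin_snd_pos hζ).le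
    (hf.curvature_nonneg (hf.abscissa_pos hT.1)) (hf.incidence_sq hζ h₀) ?_ ?_
    (hf.deriv_mul_incidence hζ hT.1 hz hv hσ) (hf.sin_returnMap_mul_deriv hζ hT.1 hz hv hσ)
  · rw [mul_pow, hσ₁, hσ₂, one_mul]
  · have : u.1 * u.2 ≤ 0 := hu
    nlinarith [mul_nonneg (hf.curvature_nonneg (hf.abscissa_pos hζ.1)) (sq_nonneg u.1)]

end Cone

/-! ### Nearly tangential line elements in the cusp -/

section NestedCone

variable {f : ℝ → ℝ} {ζ : ℝ × ℝ}

namespace IsProfile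

theorem sin_wallAngle_pos (hf : IsProfile f) {x : ℝ} (hx : 0 < x) :
    0 < Real.sin (wallAngle f x) := by
  rw [sin_wallAngle]
  exact mul_pos (neg_pos.2 (hf.deriv_neg hx)) (cos_wallAngle_pos x)

theorem sin_wallAngle_le (hf : IsProfile f) {x : ℝ} (hx : 0 < x) :
    Real.sin (wallAngle f x) ≤ -deriv f x := by
  rw [sin_wallAngle]
  exact mul_le_of_le_one_right (neg_pos.2 (hf.deriv_neg hx)).le (Real.cos_le_one _)

theorem sin_direction_eq (hf : IsProfile f) (hζ : ζ ∈ phaseSpace)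
    (h₀ : (collisionPoint f ζ).1 ≠ 0) : Real.sin (direction f ζ) =
      -((quadrant f ζ).1 * Real.cos (wallAngle f (abscissa f (returnMap f ζ).1)) *
        incidence f ζ) +
      (quadrant f ζ).2 * Real.sin (wallAngle f (abscissa f (returnMap f ζ).1)) *
        Real.cos (returnMap f ζ).2 := by
  obtain ⟨hσ₁, hσ₂⟩ := sq_eq_one_of_mem_collisionQuadrants (hf.quadrant_mem hζ h₀)
  rw [incidence, hf.cos_returnMap_eq]
  generalize wallAngle f (abscissa f (returnMap f ζ).1) = α
  linear_combination -(Real.cos α ^ 2 * Real.sin (direction f ζ)) * hσ₁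
    - Real.sin α ^ 2 * Real.sin (direction f ζ) * hσ₂
    - Real.sin (direction f ζ) * Real.sin_sq_add_cos_sq α

theorem abs_velocity_snd_le (hf : IsProfile f) (hζ : ζ ∈ phaseSpace)
    (hT : returnMap f ζ ∈ phaseSpace) : |(velocity f ζ).2| ≤
      Real.sin (returnMap f ζ).2 + -deriv f (abscissa f (returnMap f ζ).1) := by
  have h₀ := collisionPoint_fst_ne_zero hT.1
  have hx := hf.abscissa_pos hT.1
  obtain ⟨hσ₁, hσ₂⟩ := sq_eq_one_of_mem_collisionQuadrants (hf.quadrant_mem hζ h₀)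
  rw [← one_pow 2, sq_eq_sq_iff_abs_eq_abs, abs_one] at hσ₁ hσ₂
  have hincidence : |incidence f ζ| = Real.sin (returnMap f ζ).2 := by
    rw [← abs_of_pos (sin_snd_pos hT)]
    exact (sq_eq_sq_iff_abs_eq_abs _ _).1 (hf.incidence_sq hζ h₀)
  rw [velocity_eq, abs_neg, hf.sin_direction_eq hζ h₀]
  refine (abs_add_le _ _).trans (add_le_add ?_ ?_)
  · rw [abs_neg, abs_mul, abs_mul, hσ₁, hincidence, one_mul]
    exact mul_le_of_le_one_left (sin_snd_pos hT).le (Real.abs_cos_le_one _)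
  · rw [abs_mul, abs_mul, hσ₂, one_mul, abs_of_pos (hf.sin_wallAngle_pos hx)]
    exact (mul_le_of_le_one_right (hf.sin_wallAngle_pos hx).le (Real.abs_cos_le_one _)).trans
      (hf.sin_wallAngle_le hx)

theorem abs_collisionPoint_fst_le (hf : IsProfile f) (hζ : ζ ∈ phaseSpace)
    (h : (collisionPoint f ζ).1 < 0) : |(collisionPoint f ζ).1| ≤ flightTime f ζ := by
  have hspeed : |(velocity f ζ).1| ≤ 1 := by
    rw [← sq_le_one_iff_abs_le_one]
    nlinarith [velocity_sq (f := f) ζ]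
  rw [abs_of_neg h, collisionPoint_fst]
  nlinarith [hf.flightTime_pos hζ, hf.abscissa_pos hζ.1, neg_abs_le (velocity f ζ).1]

theorem height_collisionPoint_le (hf : IsProfile f) (hζ : ζ ∈ phaseSpace)
    (h : (collisionPoint f ζ).2 < 0) :
    f |(collisionPoint f ζ).1| ≤ flightTime f ζ * |(velocity f ζ).2| := by
  rw [← hf.collisionPoint_mem_boundary hζ, abs_of_neg h, collisionPoint_snd]
  nlinarith [hf.flightTime_pos hζ, hf.pos _ (hf.abscissa_pos hζ.1).le,
    neg_abs_le (velocity f ζ).2]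

theorem one_le_flightTime_mul (hf : IsProfile f) {K M : ℝ} (hK : 1 ≤ K) (hM : 0 ≤ M)
    (hζ : ζ ∈ phaseSpace) (hT : returnMap f ζ ∈ phaseSpace)
    (hx : 1 ≤ abscissa f (returnMap f ζ).1)
    (hfK : -deriv f (abscissa f (returnMap f ζ).1) ≤ K * f (abscissa f (returnMap f ζ).1))
    (hsin : Real.sin (returnMap f ζ).2 ≤ M * -deriv f (abscissa f (returnMap f ζ).1)) :
    1 ≤ flightTime f ζ * ((1 + M) * K) := by
  have hτ := hf.flightTime_pos hζ
  have hvel := hf.abs_velocity_snd_le hζ hT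
  have hy := hf.pos _ (hf.abscissa_pos hT.1).le
  rw [hf.abscissa_returnMap] at *
  rcases hf.collisionPoint_neg hζ with h | h
  · have hτ₁ := hx.trans (hf.abs_collisionPoint_fst_le hζ h)
    exact one_le_mul_of_one_le_of_one_le hτ₁ (one_le_mul_of_one_le_of_one_le (by linarith) hK)
  · have hheight := hf.height_collisionPoint_le hζ h
    generalize f |(collisionPoint f ζ).1| = y at *
    have : |(velocity f ζ).2| ≤ (1 + M) * K * y := by nlinarith
    nlinarith

theorem abs_snd_le_of_mem_nestedCone (hf : IsProfile f) {K X M : ℝ} (hK : 1 ≤ K) (hX : 1 ≤ X)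
    (hKX : ∀ x, X ≤ x → deriv (deriv f) x ≤ K * -deriv f x ∧ -deriv f x ≤ K * f x)
    (hM : 0 ≤ M) (hζ : ζ ∈ phaseSpace) (hx : X ≤ abscissa f ζ.1)
    (hsin : Real.sin ζ.2 ≤ M * -deriv f (abscissa f ζ.1)) {v : ℝ × ℝ} (hv : v ∈ nestedCone f ζ) :
    |v.2| ≤ (K + M * (1 + M) * K) * -deriv f (abscissa f ζ.1) * |v.1| := by
  obtain ⟨z, hz, rfl, u, hu, rfl⟩ := hv
  refine (hf.abs_fderiv_returnMap_snd_le hz.1 hζ hu).trans ?_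
  refine mul_le_mul_of_nonneg_right ?_ (abs_nonneg _)
  obtain ⟨hsecond, hfirst⟩ := hKX _ hx
  have hflight := hf.one_le_flightTime_mul hK hM hz.1 hζ (hX.trans hx) hfirst hsin
  have hcurv := (hf.curvature_le (hf.abscissa_pos hζ.1)).trans hsecond
  have hdiv : Real.sin (returnMap f z).2 / flightTime f z ≤
      M * (1 + M) * K * -deriv f (abscissa f (returnMap f z).1) := by
    rw [div_le_iff₀ (hf.flightTime_pos hz.1)]
    have := mul_nonneg hM (neg_nonneg.2 (hf.deriv_neg (hf.abscissa_pos hζ.1)).le)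
    nlinarith
  linarith

end IsProfile

end NestedCone

/-! ### The singularity curves -/

section Singularities

variable {f : ℝ → ℝ} {ζ : ℝ × ℝ}

/-- `m` is the slope of the line from `(x, f x)` that is tangent to the wall in the second
quadrant. -/
def IsLeftSlope (f : ℝ → ℝ) (x m : ℝ) : Prop :=
  ∃ s, 0 < s ∧ m = -deriv f s ∧ f x = f s + m * (x + s)

/-- `m` is the slope of the line from `(x, f x)` that supports the wall in the fourth quadrant, at
the vertex or tangentially. -/
def IsRightSlope (f : ℝ → ℝ) (x m : ℝ) : Prop :=
  ∃ s, 0 ≤ s ∧ s < x ∧ 0 < m ∧ f x + f s = m * (x - s) ∧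
    (∀ X, 0 ≤ X → f s + m * s ≤ f X + m * X) ∧ (s = 0 ∨ (0 < s ∧ m = -deriv f s))

/-- The angle with `∂/∂r` of the direction of slope `m` pointing to the left from the point of the
wall at abscissa `x`. -/
noncomputable def slopeAngle (f : ℝ → ℝ) (x m : ℝ) : ℝ :=
  Real.pi - Real.arctan m - wallAngle f x

theorem snd_eq_of_velocity (hζ : ζ ∈ phaseSpace) {m : ℝ} (h₁ : (velocity f ζ).1 < 0)
    (h₂ : (velocity f ζ).2 = m * (velocity f ζ).1) :
    ζ.2 = slopeAngle f (abscissa f ζ.1) m := by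
  have hα := wallAngle_mem (f := f) (abscissa f ζ.1)
  have hφ := hζ.2
  rw [velocity_eq] at h₁ h₂
  dsimp only at h₁ h₂
  have htan : Real.tan (direction f ζ - Real.pi) = -m := by
    rw [Real.tan_sub_pi, Real.tan_eq_sin_div_cos, div_eq_iff h₁.ne]
    linarith
  have hlt : Real.pi / 2 < direction f ζ := by
    by_contra! h
    refine h₁.not_ge (Real.cos_nonneg_of_neg_pi_div_two_le_of_le ?_ h)
    rw [direction]
    linarith [hφ.1, hα.1]
  have harctan := Real.arctan_tan (x := direction f ζ - Real.pi) (by linarith)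
    (by rw [direction]; linarith [hφ.2, hα.2])
  rw [htan, Real.arctan_neg, direction] at harctan
  rw [slopeAngle]
  linarith

theorem IsProfile.velocity_snd_eq_of_tangential (hf : IsProfile f) (hζ : ζ ∈ phaseSpace)
    (h₀ : (collisionPoint f ζ).1 ≠ 0) (hσ : (quadrant f ζ).1 * (quadrant f ζ).2 = -1)
    (h : |tangentialSpeed f ζ| = 1) :
    (velocity f ζ).2 = -deriv f |(collisionPoint f ζ).1| * (velocity f ζ).1 := by
  obtain ⟨hσ₁, -⟩ := sq_eq_one_of_mem_collisionQuadrants (hf.quadrant_mem hζ h₀)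
  have hincidence : incidence f ζ = 0 := by
    rw [← sq_eq_zero_iff, hf.incidence_sq hζ h₀, Real.sin_sq, cos_returnMap, ← sq_abs, h]
    norm_num
  rw [incidence, hf.abscissa_returnMap, sin_wallAngle] at hincidence
  refine mul_left_cancel₀ (cos_wallAngle_pos (f := f) |(collisionPoint f ζ).1|).ne' ?_
  rw [velocity_eq]
  generalize Real.cos (wallAngle f |(collisionPoint f ζ).1|) = c at *
  linear_combination (quadrant f ζ).1 * hincidence +
    c * Real.sin (direction f ζ) * hσ₁ +
    c * deriv f |(collisionPoint f ζ).1| * Real.cos (direction f ζ) * hσ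

theorem IsProfile.exists_isLeftSlope (hf : IsProfile f) (hζ : ζ ∈ singPlus f 1) :
    ∃ m, 0 < m ∧ IsLeftSlope f (abscissa f ζ.1) m ∧
      ζ.2 = slopeAngle f (abscissa f ζ.1) m := by
  obtain ⟨hp, h₁, h₂, htangential⟩ := hζ
  have hb := hf.collisionPoint_mem_boundary hp
  have hpar := hf.velocity_snd_eq_of_tangential hp h₁.ne
    (by rw [quadrant, Real.sign_of_neg h₁, Real.sign_of_pos h₂]; norm_num) htangential
  have hv : (velocity f ζ).1 < 0 := by
    rw [collisionPoint_fst] at h₁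
    by_contra! h
    nlinarith [mul_nonneg (hf.flightTime_pos hp).le h, hf.abscissa_pos hp.1]
  have hs : 0 < |(collisionPoint f ζ).1| := abs_pos.2 h₁.ne
  refine ⟨-deriv f |(collisionPoint f ζ).1|, neg_pos.2 (hf.deriv_neg hs), ⟨_, hs, rfl, ?_⟩,
    snd_eq_of_velocity hp hv hpar⟩
  rw [abs_of_pos h₂, collisionPoint_snd, hpar] at hb
  have hfst := abs_of_neg h₁
  nth_rw 2 [collisionPoint_fst] at hfst
  linear_combination hb + deriv f |(collisionPoint f ζ).1| * hfst

theorem IsProfile.isRightSlope_of_vertex (hf : IsProfile f) (hζ : ζ ∈ phaseSpace)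
    (h₂ : (collisionPoint f ζ).2 < 0) (h₁ : (collisionPoint f ζ).1 = 0) :
    ∃ m, 0 < m ∧ IsRightSlope f (abscissa f ζ.1) m ∧
      ζ.2 = slopeAngle f (abscissa f ζ.1) m := by
  have hτ := hf.flightTime_pos hζ
  have hx := hf.abscissa_pos hζ.1
  have hb := hf.collisionPoint_mem_boundary hζ
  rw [abs_of_neg h₂, h₁, abs_zero, collisionPoint_snd] at hb
  rw [collisionPoint_fst] at h₁
  have hv : (velocity f ζ).1 < 0 := by
    by_contra! h
    nlinarith [mul_nonneg hτ.le h]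
  have hsum : 0 < f (abscissa f ζ.1) + f 0 := add_pos (hf.pos _ hx.le) (hf.pos 0 le_rfl)
  obtain ⟨m, hmx⟩ : ∃ m, m * abscissa f ζ.1 = f (abscissa f ζ.1) + f 0 :=
    ⟨_, div_mul_cancel₀ _ hx.ne'⟩
  have hm : 0 < m := pos_of_mul_pos_left (hmx ▸ hsum) hx.le
  have hpar : (velocity f ζ).2 = m * (velocity f ζ).1 := by
    refine mul_left_cancel₀ hτ.ne' ?_
    linear_combination -hb - m * h₁ + hmx
  refine ⟨m, hm, ⟨0, le_rfl, hx, hm, by linarith, fun X hX => ?_, Or.inl rfl⟩,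
    snd_eq_of_velocity hζ hv hpar⟩
  rcases hX.eq_or_lt with rfl | hX₀
  · exact le_rfl
  rcases le_or_gt (abscissa f ζ.1) X with hXx | hXx
  · rw [mul_zero]
    linarith [mul_le_mul_of_nonneg_left hXx hm.le, hf.pos X hX, hf.pos _ hx.le]
  -- below abscissa `X` the ray is still inside the table
  obtain ⟨t, htv⟩ : ∃ t, t * (velocity f ζ).1 = X - abscissa f ζ.1 :=
    ⟨_, div_mul_cancel₀ _ hv.ne⟩
  have hin := hf.abs_ray_lt hζ (t := t) (by nlinarith) (by nlinarith)
  rw [ray_fst, ray_snd, hpar, htv, add_sub_cancel, abs_of_pos hX₀, mul_left_comm, htv] at hin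
  linarith [(abs_lt.1 hin).1]

theorem IsProfile.isRightSlope_of_tangency (hf : IsProfile f) (hζ : ζ ∈ phaseSpace)
    (h₂ : (collisionPoint f ζ).2 < 0) (h₁ : 0 < (collisionPoint f ζ).1)
    (htangential : |tangentialSpeed f ζ| = 1) :
    ∃ m, 0 < m ∧ IsRightSlope f (abscissa f ζ.1) m ∧
      ζ.2 = slopeAngle f (abscissa f ζ.1) m := by
  have hτ := hf.flightTime_pos hζ
  have hy := hf.pos _ (hf.abscissa_pos hζ.1).le
  have hb := hf.collisionPoint_mem_boundary hζ
  have hpar := hf.velocity_snd_eq_of_tangential hζ h₁.ne'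
    (by rw [quadrant, Real.sign_of_neg h₂, Real.sign_of_pos h₁]; norm_num) htangential
  have hfst := collisionPoint_fst (f := f) ζ
  rw [abs_of_pos h₁] at hb hpar
  generalize (collisionPoint f ζ).1 = s at *
  rw [abs_of_neg h₂, collisionPoint_snd] at hb
  have hm := hf.deriv_neg h₁
  have hfall : (velocity f ζ).2 < 0 := by
    by_contra! h
    nlinarith [mul_nonneg hτ.le h, hf.pos s h₁.le]
  have hv : (velocity f ζ).1 < 0 := by
    by_contra! h
    nlinarith
  refine ⟨-deriv f s, neg_pos.2 hm, ⟨s, h₁.le, by nlinarith, neg_pos.2 hm, ?_, fun X hX => ?_,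
    Or.inr ⟨h₁, rfl⟩⟩, snd_eq_of_velocity hζ hv hpar⟩
  · rw [hpar] at hb
    linear_combination -hb - deriv f s * hfst
  · linarith [hf.tangent_le h₁ hX]

theorem IsProfile.exists_isRightSlope (hf : IsProfile f) (hζ : ζ ∈ singPlus f 2) :
    ∃ m, 0 < m ∧ IsRightSlope f (abscissa f ζ.1) m ∧
      ζ.2 = slopeAngle f (abscissa f ζ.1) m := by
  obtain ⟨hp, h₂, h₁ | ⟨h₁, htangential⟩⟩ := hζ
  · exact hf.isRightSlope_of_vertex hp h₂ h₁
  · exact hf.isRightSlope_of_tangency hp h₂ h₁ htangential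

section Slopes

variable {x x' m m' : ℝ}

theorem IsLeftSlope.antitone (hf : IsProfile f) (hx : 0 < x) (hxx' : x ≤ x')
    (h : IsLeftSlope f x m) (h' : IsLeftSlope f x' m') : m' ≤ m := by
  obtain ⟨s, hs, rfl, he⟩ := h
  obtain ⟨s', hs', -, he'⟩ := h'
  by_contra! hlt
  have htangent := hf.tangent_le hs hs'.le
  have hanti := hf.le_of_le hx.le hxx'
  nlinarith [mul_pos (sub_pos.2 hlt) hs', mul_pos (sub_pos.2 hlt) hx,
    mul_nonneg (neg_nonneg.2 (hf.deriv_neg hs).le) (sub_nonneg.2 hxx'),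
    mul_nonneg (sub_pos.2 hlt).le (sub_nonneg.2 hxx')]

theorem IsRightSlope.antitone (hf : IsProfile f) (hx : 0 < x) (hxx' : x ≤ x')
    (h : IsRightSlope f x m) (h' : IsRightSlope f x' m') : m' ≤ m := by
  obtain ⟨s, hs, hsx, hm, he, -, -⟩ := h
  obtain ⟨s', -, -, -, he', hmin, -⟩ := h'
  by_contra! hlt
  have hsupport := hmin s hs
  have hanti := hf.le_of_le hx.le hxx'
  nlinarith [mul_pos (sub_pos.2 hlt) (show 0 < x' - s by linarith),
    mul_nonneg hm.le (sub_nonneg.2 hxx')]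

theorem IsLeftSlope.le_neg_deriv (hf : IsProfile f) (hx : 0 < x) (h : IsLeftSlope f x m) :
    m ≤ -deriv f x := by
  obtain ⟨s, hs, rfl, he⟩ := h
  have hm := hf.deriv_neg hs
  have hlt : x < s := (hf.strictAntiOn.lt_iff_gt hs.le hx.le).1 (by nlinarith)
  linarith [hf.monotoneOn_deriv hx hs hlt.le]

theorem IsProfile.exists_isRightSlope_le (hf : IsProfile f) (h₂ : A2 f) :
    ∃ C X : ℝ, 1 ≤ C ∧ ∀ x, X ≤ x → ∀ m, IsRightSlope f x m → m ≤ C * -deriv f x := by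
  obtain ⟨C, hC⟩ := h₂
  have hf₀₁ : f 1 < f 0 := hf.strictAntiOn self_mem_Ici (mem_Ici.2 zero_le_one) one_pos
  obtain ⟨X, hX⟩ := eventually_atTop.1 <|
    (hC.and (eventually_ge_atTop 1)).and (eventually_ge_atTop ((2 * f 0 + 1) / (f 0 - f 1)))
  refine ⟨max C 1, X, le_max_right _ _, fun x hx m hm => ?_⟩
  obtain ⟨⟨hA2, hx₁⟩, hx₂⟩ := hX x hx
  have hx₀ : 0 < x := one_pos.trans_le hx₁
  have hd := hf.deriv_neg hx₀
  obtain ⟨s, -, hsx, hm₀, he, hmin, rfl | ⟨hs, hms⟩⟩ := hm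
  · exfalso
    rw [div_le_iff₀ (by linarith)] at hx₂
    nlinarith [hmin 1 zero_le_one, hf.le_of_le le_rfl hx₀.le]
  · have hle := hA2 s ⟨hs, hsx, by rw [he, hms, mul_div_cancel_right₀ _ (by linarith)]⟩
    rw [abs_of_neg hd, abs_of_neg (hf.deriv_neg hs), ← hms] at hle
    exact hle.trans (mul_le_mul_of_nonneg_right (le_max_left _ _) (by linarith))

theorem IsLeftSlope.sub_le (hf : IsProfile f) (hx : 1 ≤ x) (hxx' : x ≤ x')
    (h : IsLeftSlope f x m) (h' : IsLeftSlope f x' m') :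
    m - m' ≤ 2 * -deriv f x * (x' - x) := by
  have hx₀ : 0 < x := one_pos.trans_le hx
  have hle := h'.le_neg_deriv hf (hx₀.trans_le hxx')
  have hanti := h.antitone hf hx₀ hxx' h'
  have hmono := hf.monotoneOn_deriv hx₀ (hx₀.trans_le hxx') hxx'
  have htangent := hf.tangent_le hx₀ (hx₀.le.trans hxx')
  obtain ⟨s, hs, -, he⟩ := h
  obtain ⟨s', hs', hm', he'⟩ := h'
  have htangent' := hf.tangent_le hs' hs.le
  rw [← neg_eq_iff_eq_neg.2 hm'] at htangent'
  calc m - m' ≤ (m - m') * x := le_mul_of_one_le_right (sub_nonneg.2 hanti) hx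
    _ ≤ (-deriv f x + m') * (x' - x) := by
      nlinarith [mul_nonneg (sub_nonneg.2 hanti) hs.le]
    _ ≤ 2 * -deriv f x * (x' - x) :=
      mul_le_mul_of_nonneg_right (by linarith) (sub_nonneg.2 hxx')

theorem IsRightSlope.sub_le (hf : IsProfile f) {C K : ℝ} (hC : 1 ≤ C) (hK : 1 ≤ K)
    (hx : 0 < x) (hxx' : x ≤ x') (hfK : -deriv f x' ≤ K * f x') (hmC : m' ≤ C * -deriv f x')
    (hδ : x' - x ≤ 1 / (2 * C * K)) (h : IsRightSlope f x m) (h' : IsRightSlope f x' m') :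
    m - m' ≤ 2 * C * K * (1 + C) * -deriv f x * (x' - x) := by
  have hanti := h.antitone hf hx hxx' h'
  have hmono := hf.monotoneOn_deriv hx (hx.trans_le hxx') hxx'
  have htangent := hf.tangent_le hx (hx.le.trans hxx')
  obtain ⟨s, hs, hsx, hm, he, hmin, -⟩ := h
  obtain ⟨s', hs', hsx', -, he', -, -⟩ := h'
  have hsupport := hmin s' hs'
  have hfx' := hf.pos x' (hx.le.trans hxx')
  have hfs' := hf.pos s' hs'
  have hCK : 0 < C * K := by positivity
  have hdist' : 1 ≤ C * K * (x' - s') := by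
    have hslope : m' ≤ C * K * f x' := by nlinarith
    have := mul_le_mul_of_nonneg_right hslope (sub_nonneg.2 hsx'.le)
    nlinarith
  have hdist : 1 ≤ 2 * C * K * (x - s') := by
    rw [le_div_iff₀ (by positivity)] at hδ
    linarith
  have hcross : (m - m') * (x - s') ≤ (1 + C) * -deriv f x * (x' - x) :=
    calc (m - m') * (x - s') ≤ (-deriv f x + m') * (x' - x) := by linarith
      _ ≤ (1 + C) * -deriv f x * (x' - x) :=
        mul_le_mul_of_nonneg_right (by nlinarith) (sub_nonneg.2 hxx')
  calc m - m' ≤ (m - m') * (2 * C * K * (x - s')) :=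
        le_mul_of_one_le_right (sub_nonneg.2 hanti) hdist
    _ = 2 * C * K * ((m - m') * (x - s')) := by ring
    _ ≤ 2 * C * K * ((1 + C) * -deriv f x * (x' - x)) :=
      mul_le_mul_of_nonneg_left hcross (by positivity)
    _ = _ := by ring

end Slopes

end Singularities

/-! ### Quantitative bounds on the singularity curves -/

section SingularBounds

theorem abs_arctan_sub_arctan_le (a b : ℝ) : |Real.arctan a - Real.arctan b| ≤ |a - b| := by
  have hlip : LipschitzWith 1 Real.arctan :=
    lipschitzWith_of_nnnorm_deriv_le Real.differentiable_arctan fun x => by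
      rw [← NNReal.coe_le_coe, coe_nnnorm, NNReal.coe_one, Real.deriv_arctan,
        Real.norm_of_nonneg (by positivity), div_le_one (by positivity)]
      linarith [sq_nonneg x]
  simpa [edist_dist, Real.dist_eq] using hlip a b

theorem arctan_le_self {a : ℝ} (ha : 0 ≤ a) : Real.arctan a ≤ a := by
  simpa only [Real.tan_arctan] using
    Real.le_tan (Real.arctan_nonneg.2 ha) (Real.arctan_lt_pi_div_two a)

variable {f : ℝ → ℝ}

/-- The absolute slope of the wall as a function of arc length. -/
noncomputable def wallSlope (f : ℝ → ℝ) (r : ℝ) : ℝ := -deriv f (abscissa f r)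

namespace IsProfile

theorem wallSlope_pos (hf : IsProfile f) {r : ℝ} (hr : 0 < r) : 0 < wallSlope f r :=
  neg_pos.2 (hf.deriv_neg (hf.abscissa_pos hr))

theorem wallSlope_anti (hf : IsProfile f) {r r' : ℝ} (hr : 0 < r) (hrr' : r ≤ r') :
    wallSlope f r' ≤ wallSlope f r :=
  neg_le_neg (hf.monotoneOn_deriv (hf.abscissa_pos hr) (hf.abscissa_pos (hr.trans_le hrr'))
    (hf.abscissa_le_abscissa hr.le hrr'))

theorem le_abscissa (hf : IsProfile f) {X r : ℝ} (hX : 0 ≤ X) (hr : arcLength f X ≤ r) :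
    X ≤ abscissa f r := by
  have := hf.abscissa_le_abscissa (hf.arcLength_nonneg hX) hr
  rwa [hf.abscissa_arcLength hX] at this

theorem wallSlope_le_two_mul (hf : IsProfile f) {K X : ℝ} (hK : 0 < K) (hX : 0 < X)
    (hKX : ∀ x, X ≤ x → deriv (deriv f) x ≤ K * -deriv f x) {r r' : ℝ}
    (hr : arcLength f X ≤ r) (hr' : arcLength f X ≤ r') (h : |r - r'| ≤ Real.log 2 / K) :
    wallSlope f r ≤ 2 * wallSlope f r' := by
  have hr₀ := (hf.arcLength_pos hX).trans_le hr
  have hr₀' := (hf.arcLength_pos hX).trans_le hr'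
  rcases le_total r r' with hrr' | hrr'
  · refine (hf.neg_deriv_le_exp_mul hX hKX (hf.le_abscissa hX.le hr)
      (hf.abscissa_le_abscissa hr₀.le hrr')).trans ?_
    refine mul_le_mul_of_nonneg_right ?_ (hf.wallSlope_pos hr₀').le
    rw [← Real.le_log_iff_exp_le two_pos, mul_comm, ← le_div_iff₀ hK]
    exact (hf.abscissa_sub_le hr₀.le hrr').trans ((le_abs_self _).trans (abs_sub_comm r r' ▸ h))
  · linarith [hf.wallSlope_anti hr₀' hrr', hf.wallSlope_pos hr₀']

theorem wallAngle_anti (hf : IsProfile f) {x x' : ℝ} (hx : 0 < x) (hxx' : x ≤ x') :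
    wallAngle f x' ≤ wallAngle f x :=
  neg_le_neg (Real.arctan_mono (hf.monotoneOn_deriv hx (hx.trans_le hxx') hxx'))

theorem wallAngle_le (hf : IsProfile f) {x : ℝ} (hx : 0 < x) : wallAngle f x ≤ -deriv f x := by
  rw [wallAngle, ← Real.arctan_neg]
  exact arctan_le_self (neg_pos.2 (hf.deriv_neg hx)).le

theorem abs_wallAngle_sub_le (hf : IsProfile f) {K x x' : ℝ} (hK : 0 ≤ K) (hx : 0 < x)
    (hKx : ∀ y, x ≤ y → deriv (deriv f) y ≤ K * -deriv f y) (hxx' : x ≤ x') :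
    |wallAngle f x' - wallAngle f x| ≤ K * -deriv f x * (x' - x) := by
  have hmean := (convex_Icc x x').norm_image_sub_le_of_norm_deriv_le (f := deriv f)
    (C := K * -deriv f x) (fun y hy => hf.differentiable₂ y (hx.trans_le hy.1)) (fun y hy => by
      rw [Real.norm_of_nonneg (hf.deriv_deriv_nonneg (hx.trans_le hy.1))]
      exact (hKx y hy.1).trans (mul_le_mul_of_nonneg_left
        (neg_le_neg (hf.monotoneOn_deriv hx (hx.trans_le hy.1) hy.1)) hK))
    (left_mem_Icc.2 hxx') (right_mem_Icc.2 hxx')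
  rw [Real.norm_eq_abs, Real.norm_of_nonneg (sub_nonneg.2 hxx')] at hmean
  calc |wallAngle f x' - wallAngle f x| = |Real.arctan (deriv f x') - Real.arctan (deriv f x)| := by
        rw [wallAngle, wallAngle, neg_sub_neg, abs_sub_comm]
    _ ≤ |deriv f x' - deriv f x| := abs_arctan_sub_arctan_le _ _
    _ ≤ _ := hmean

theorem slopeAngle_le_slopeAngle (hf : IsProfile f) {x x' m m' : ℝ} (hx : 0 < x) (hxx' : x ≤ x')
    (hm : m' ≤ m) : slopeAngle f x m ≤ slopeAngle f x' m' :=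
  sub_le_sub (sub_le_sub_left (Real.arctan_mono hm) _) (hf.wallAngle_anti hx hxx')

theorem sin_slopeAngle_le (hf : IsProfile f) {x m : ℝ} (hx : 0 < x) (hm : 0 < m) :
    Real.sin (slopeAngle f x m) ≤ m + -deriv f x := by
  have hwall := hf.wallAngle_pos hx
  have harctan := Real.arctan_pos.2 hm
  rw [slopeAngle, sub_sub, Real.sin_pi_sub]
  exact (Real.sin_le (by linarith)).trans (add_le_add (arctan_le_self hm.le) (hf.wallAngle_le hx))

theorem abs_slopeAngle_sub_le (hf : IsProfile f) {K x x' m m' : ℝ} (hK : 0 ≤ K) (hx : 0 < x)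
    (hKx : ∀ y, x ≤ y → deriv (deriv f) y ≤ K * -deriv f y) (hxx' : x ≤ x') :
    |slopeAngle f x' m' - slopeAngle f x m| ≤ |m - m'| + K * -deriv f x * (x' - x) := by
  rw [show slopeAngle f x' m' - slopeAngle f x m =
    (Real.arctan m - Real.arctan m') - (wallAngle f x' - wallAngle f x) by
      rw [slopeAngle, slopeAngle]; ring]
  exact (abs_sub _ _).trans
    (add_le_add (abs_arctan_sub_arctan_le _ _) (hf.abs_wallAngle_sub_le hK hx hKx hxx'))

end IsProfile

/-- `m` is a slope at which the line element at abscissa `x` lies on the singularity curve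
`F^{i+}`, for `i = 1, 2`. -/
def IsSingularSlope (f : ℝ → ℝ) (i : Fin 3) (x m : ℝ) : Prop :=
  (i = 1 ∧ IsLeftSlope f x m) ∨ (i = 2 ∧ IsRightSlope f x m)

theorem IsProfile.exists_isSingularSlope (hf : IsProfile f) {i : Fin 3} (hi : i ≠ 0)
    {ζ : ℝ × ℝ} (hζ : ζ ∈ singPlus f i) : 0 < ζ.1 ∧ ∃ m, 0 < m ∧
      IsSingularSlope f i (abscissa f ζ.1) m ∧ ζ.2 = slopeAngle f (abscissa f ζ.1) m := by
  fin_cases i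
  · exact absurd rfl hi
  · obtain ⟨m, hm, hleft, hangle⟩ := hf.exists_isLeftSlope hζ
    exact ⟨hζ.1.1, m, hm, Or.inl ⟨rfl, hleft⟩, hangle⟩
  · obtain ⟨m, hm, hright, hangle⟩ := hf.exists_isRightSlope hζ
    exact ⟨hζ.1.1, m, hm, Or.inr ⟨rfl, hright⟩, hangle⟩

theorem IsSingularSlope.antitone (hf : IsProfile f) {i : Fin 3} {x x' m m' : ℝ} (hx : 0 < x)
    (hxx' : x ≤ x') (h : IsSingularSlope f i x m) (h' : IsSingularSlope f i x' m') :
    m' ≤ m := by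
  rcases h with ⟨rfl, h⟩ | ⟨rfl, h⟩ <;> rcases h' with ⟨h₀, h'⟩ | ⟨h₀, h'⟩
  · exact h.antitone hf hx hxx' h'
  · exact absurd h₀ (by decide)
  · exact absurd h₀ (by decide)
  · exact h.antitone hf hx hxx' h'

theorem IsProfile.snd_le_snd_of_mem_singPlus (hf : IsProfile f) {i : Fin 3} {ζ ζ' : ℝ × ℝ}
    (hζ : ζ ∈ singPlus f i) (hζ' : ζ' ∈ singPlus f i) (h : ζ.1 ≤ ζ'.1) : ζ.2 ≤ ζ'.2 := by
  rcases eq_or_ne i 0 with rfl | hi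
  · exact (hζ.2.trans hζ'.2.symm : ζ.2 = ζ'.2).le
  · obtain ⟨hr, m, -, hm, hangle⟩ := hf.exists_isSingularSlope hi hζ
    obtain ⟨-, m', -, hm', hangle'⟩ := hf.exists_isSingularSlope hi hζ'
    rw [hangle, hangle']
    have hx := hf.abscissa_pos hr
    have hxx' := hf.abscissa_le_abscissa hr.le h
    exact hf.slopeAngle_le_slopeAngle hx hxx' (hm.antitone hf hx hxx' hm')

section Cusp

variable {K X : ℝ}

theorem IsProfile.exists_isSingularSlope_bounds (hf : IsProfile f) (h₂ : A2 f) (hK : 1 ≤ K)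
    (hX : 1 ≤ X) (hKX : ∀ x, X ≤ x → -deriv f x ≤ K * f x) :
    ∃ C Y δ : ℝ, 1 ≤ C ∧ X ≤ Y ∧ 0 < δ ∧ ∀ i x m, Y ≤ x → IsSingularSlope f i x m →
      m ≤ C * -deriv f x ∧ ∀ x' m', x ≤ x' → x' - x ≤ δ → IsSingularSlope f i x' m' →
        m - m' ≤ C * -deriv f x * (x' - x) := by
  obtain ⟨C₀, X₀, hC₀, hright⟩ := hf.exists_isRightSlope_le h₂
  refine ⟨2 * C₀ * K * (1 + C₀), max X X₀, 1 / (2 * C₀ * K), ?_, le_max_left _ _, by positivity,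
    fun i x m hx h => ?_⟩
  · nlinarith [one_le_mul_of_one_le_of_one_le hC₀ hK]
  obtain ⟨hxX, hxX₀⟩ := max_le_iff.1 hx
  have hx₀ : 0 < x := by linarith
  have hslope := neg_pos.2 (hf.deriv_neg hx₀)
  have hC : max C₀ 2 ≤ 2 * C₀ * K * (1 + C₀) :=
    max_le (by nlinarith [one_le_mul_of_one_le_of_one_le hC₀ hK])
      (by nlinarith [one_le_mul_of_one_le_of_one_le hC₀ hK])
  have hbound : ∀ {c}, c ≤ max C₀ 2 → c * -deriv f x ≤ 2 * C₀ * K * (1 + C₀) * -deriv f x :=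
    fun hc => mul_le_mul_of_nonneg_right (hc.trans hC) hslope.le
  rcases h with ⟨rfl, h⟩ | ⟨rfl, h⟩
  · refine ⟨(h.le_neg_deriv hf hx₀).trans ?_, fun x' m' hxx' _ h' => ?_⟩
    · simpa only [one_mul] using hbound (le_max_of_le_left hC₀)
    rcases h' with ⟨-, h'⟩ | ⟨h₀, -⟩
    · exact (h.sub_le hf (hX.trans hxX) hxx' h').trans
        (mul_le_mul_of_nonneg_right (hbound (le_max_right _ _)) (sub_nonneg.2 hxx'))
    · exact absurd h₀ (by decide)
  · refine ⟨(hright x hxX₀ m h).trans (hbound (le_max_left _ _)), fun x' m' hxx' hδ h' => ?_⟩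
    rcases h' with ⟨h₀, -⟩ | ⟨-, h'⟩
    · exact absurd h₀ (by decide)
    · exact h.sub_le hf hC₀ hK hx₀ hxx' (hKX _ (hxX.trans hxx'))
        (hright _ (hxX₀.trans hxx') m' h') hδ h'

theorem IsProfile.exists_singPlus_bounds (hf : IsProfile f) (h₂ : A2 f) (hK : 1 ≤ K)
    (hX : 1 ≤ X)
    (hKX : ∀ x, X ≤ x → deriv (deriv f) x ≤ K * -deriv f x ∧ -deriv f x ≤ K * f x) :
    ∃ C R δ : ℝ, 0 < C ∧ 0 < δ ∧
      (∀ i, ∀ ζ ∈ singPlus f i, R ≤ ζ.1 → Real.sin ζ.2 ≤ C * wallSlope f ζ.1) ∧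
      (∀ i, i ≠ 0 → ∀ ζ ∈ singPlus f i, ∀ ζ' ∈ singPlus f i, R ≤ ζ.1 → ζ.1 ≤ ζ'.1 →
        ζ'.1 ≤ ζ.1 + δ → |ζ'.2 - ζ.2| ≤ C * wallSlope f ζ.1 * (ζ'.1 - ζ.1)) := by
  obtain ⟨C, Y, δ, hC, hXY, hδ, hslope⟩ :=
    hf.exists_isSingularSlope_bounds h₂ hK hX fun x hx => (hKX x hx).2
  have hY : 0 < Y := by linarith
  refine ⟨C + K, arcLength f Y, δ, by linarith, hδ, fun i ζ hζ hr => ?_,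
    fun i hi ζ hζ ζ' hζ' hr hrr' hδ' => ?_⟩
  all_goals
    have hr₀ := (hf.arcLength_pos hY).trans_le hr
    have hx := hf.abscissa_pos hr₀
    have hYx := hf.le_abscissa hY.le hr
    have hη := hf.wallSlope_pos hr₀
  · rcases eq_or_ne i 0 with rfl | hi
    · rw [show ζ.2 = Real.pi from hζ.2, Real.sin_pi]
      positivity
    · obtain ⟨-, m, hm, hsing, hangle⟩ := hf.exists_isSingularSlope hi hζ
      have hsin := hf.sin_slopeAngle_le hx hm
      rw [← hangle] at hsin
      rw [wallSlope] at hη ⊢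
      nlinarith [(hslope i _ m hYx hsing).1]
  · obtain ⟨-, m, -, hsing, hangle⟩ := hf.exists_isSingularSlope hi hζ
    obtain ⟨-, m', -, hsing', hangle'⟩ := hf.exists_isSingularSlope hi hζ'
    have hxx' := hf.abscissa_le_abscissa hr₀.le hrr'
    have hxr := hf.abscissa_sub_le hr₀.le hrr'
    have hanti := hsing.antitone hf hx hxx' hsing'
    have hlip := (hslope i _ m hYx hsing).2 _ m' hxx' (by linarith) hsing'
    have hdist := hf.abs_slopeAngle_sub_le (m := m) (m' := m') (by linarith) hx
      (fun y hy => (hKX y (hXY.trans (hYx.trans hy))).1) hxx'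
    rw [abs_of_nonneg (sub_nonneg.2 hanti)] at hdist
    calc |ζ'.2 - ζ.2| ≤ (C + K) * wallSlope f ζ.1 * (abscissa f ζ'.1 - abscissa f ζ.1) := by
          rw [hangle, hangle', wallSlope]
          linarith
      _ ≤ (C + K) * wallSlope f ζ.1 * (ζ'.1 - ζ.1) :=
          mul_le_mul_of_nonneg_left hxr (by positivity)

end Cusp

/-- Constants that control, in the cusp `R ≤ r`, the nested cones at nearly tangential line
elements, the variation of the slope of the wall, and the position of the singularity curves. -/
structure CuspBounds (f : ℝ → ℝ) (K C R δ : ℝ) : Prop where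
  cone_pos : 0 < K
  curve_pos : 0 < C
  radius_pos : 0 < R
  scale_pos : 0 < δ
  cone_le : ∀ M, 0 ≤ M → ∀ ζ ∈ phaseSpace, R ≤ ζ.1 → Real.sin ζ.2 ≤ M * wallSlope f ζ.1 →
    ∀ v ∈ nestedCone f ζ, |v.2| ≤ K * (1 + M) ^ 2 * wallSlope f ζ.1 * |v.1|
  wallSlope_le : ∀ r r', R ≤ r → R ≤ r' → |r - r'| ≤ δ → wallSlope f r ≤ 2 * wallSlope f r'
  sin_le : ∀ i F, (F = singPlus f i ∨ F = singMinus f i) → ∀ ζ ∈ F, R ≤ ζ.1 →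
    Real.sin ζ.2 ≤ C * wallSlope f ζ.1
  lipschitz : ∀ i, i ≠ 0 → ∀ ζ ∈ singMinus f i, ∀ ζ' ∈ singMinus f i, R ≤ ζ.1 → R ≤ ζ'.1 →
    |ζ'.1 - ζ.1| ≤ δ → |ζ'.2 - ζ.2| ≤ C * wallSlope f ζ.1 * |ζ'.1 - ζ.1|

theorem IsProfile.exists_cuspBounds (hf : IsProfile f) (h₂ : A2 f) (h₄ : A4 f) :
    ∃ K C R δ, CuspBounds f K C R δ := by
  obtain ⟨K, X, hK, hX, hKX⟩ := h₄.exists_bounds hf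
  obtain ⟨C, R, δ, hC, hδ, hsin, hlip⟩ := hf.exists_singPlus_bounds h₂ hK hX hKX
  have hX₀ : 0 < X := one_pos.trans_le hX
  have hK₀ : 0 < K := one_pos.trans_le hK
  have hlog : 0 < Real.log 2 / K := div_pos (Real.log_pos one_lt_two) hK₀
  have hR₀ : 0 < max (arcLength f X) R := lt_max_of_lt_left (hf.arcLength_pos hX₀)
  have hslope : ∀ r r', max (arcLength f X) R ≤ r → max (arcLength f X) R ≤ r' →
      |r - r'| ≤ min δ (Real.log 2 / K) → wallSlope f r ≤ 2 * wallSlope f r' :=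
    fun r r' hr hr' h => hf.wallSlope_le_two_mul hK₀ hX₀ (fun x hx => (hKX x hx).1)
      ((le_max_left _ _).trans hr) ((le_max_left _ _).trans hr') (h.trans (min_le_right _ _))
  refine ⟨K, 2 * C, max (arcLength f X) R, min δ (Real.log 2 / K), hK₀, by positivity, hR₀,
    lt_min hδ hlog, fun M hM ζ hζ hr hsinM v hv => ?_, hslope, fun i F hF ζ hζ hr => ?_,
    fun i hi ζ hζ ζ' hζ' hr hr' h => ?_⟩
  · have hη := hf.wallSlope_pos hζ.1
    refine (hf.abs_snd_le_of_mem_nestedCone hK hX hKX hM hζ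
      (hf.le_abscissa hX₀.le ((le_max_left _ _).trans hr)) hsinM hv).trans ?_
    refine mul_le_mul_of_nonneg_right (mul_le_mul_of_nonneg_right ?_ hη.le) (abs_nonneg _)
    nlinarith [mul_nonneg hM hK₀.le]
  · have hη := hf.wallSlope_pos (hR₀.trans_le hr)
    have hsinC : Real.sin ζ.2 ≤ C * wallSlope f ζ.1 := by
      rcases hF with rfl | rfl
      · exact hsin i ζ hζ ((le_max_right _ _).trans hr)
      · simpa only [Real.sin_pi_sub] using hsin i _ hζ ((le_max_right _ _).trans hr)
    linarith [mul_pos hC hη]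
  · have hη := hf.wallSlope_pos (hR₀.trans_le hr)
    have hδ' := h.trans (min_le_left _ _)
    have hreflect : |ζ'.2 - ζ.2| = |(Real.pi - ζ'.2) - (Real.pi - ζ.2)| := by
      rw [sub_sub_sub_cancel_left, abs_sub_comm]
    rw [hreflect]
    rcases le_total ζ.1 ζ'.1 with hle | hle
    · rw [abs_of_nonneg (sub_nonneg.2 hle)] at hδ' ⊢
      refine (hlip i hi _ hζ _ hζ' ((le_max_right _ _).trans hr) hle (by linarith)).trans ?_
      exact mul_le_mul_of_nonneg_right (by linarith [mul_pos hC hη]) (sub_nonneg.2 hle)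
    · have hη' := hslope _ _ hr' hr h
      rw [abs_sub_comm, abs_of_nonneg (sub_nonneg.2 hle)] at hδ'
      rw [abs_sub_comm, abs_sub_comm ζ'.1, abs_of_nonneg (sub_nonneg.2 hle)]
      refine (hlip i hi _ hζ' _ hζ ((le_max_right _ _).trans hr') hle (by linarith)).trans ?_
      exact mul_le_mul_of_nonneg_right (by nlinarith) (sub_nonneg.2 hle)

end SingularBounds

/-! ### Curves of finite length -/

section Length

theorem abs_deriv_le_of_eventually {g r : ℝ → ℝ} {t H : ℝ} {l : Filter ℝ} [l.NeBot]
    (hl : l ≤ 𝓝[≠] t) (hg : DifferentiableAt ℝ g t) (hr : DifferentiableAt ℝ r t)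
    (h : ∀ᶠ s in l, |g s - g t| ≤ H * |r s - r t|) : |deriv g t| ≤ H * |deriv r t| := by
  refine le_of_tendsto_of_tendsto (hg.hasDerivAt.tendsto_slope.mono_left hl).abs
    ((hr.hasDerivAt.tendsto_slope.mono_left hl).abs.const_mul H) (h.mono fun s hs => ?_)
  dsimp only
  rw [slope_def_field, slope_def_field, abs_div, abs_div, ← mul_div_assoc]
  exact div_le_div_of_nonneg_right hs (abs_nonneg _)

theorem ae_abs_deriv_le_of_forall_mem {g r H : ℝ → ℝ} {E : Set ℝ}
    (h : ∀ t ∈ E, ∀ s ∈ E, |g s - g t| ≤ H t * |r s - r t|) :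
    ∀ᵐ t : ℝ, t ∈ E → DifferentiableAt ℝ g t → DifferentiableAt ℝ r t →
      |deriv g t| ≤ H t * |deriv r t| := by
  -- only countably many points of `E` are isolated from the right
  have hisolated : volume {t ∈ E | 𝓝[E ∩ Ioi t] t = ⊥} = 0 :=
    countable_setOfPred_isolated_right_within.measure_zero volume
  filter_upwards [measure_eq_zero_iff_ae_notMem.1 hisolated] with t ht htE hg hr
  have : (𝓝[E ∩ Ioi t] t).NeBot := ⟨fun hbot => ht ⟨htE, hbot⟩⟩
  have hle : 𝓝[E ∩ Ioi t] t ≤ 𝓝[≠] t := nhdsWithin_mono t fun s hs => (ne_of_gt hs.2 : s ≠ t)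
  refine abs_deriv_le_of_eventually hle hg hr ?_
  filter_upwards [self_mem_nhdsWithin] with s hs using h t htE s hs.1

variable {a b : ℝ}

theorem ae_abs_deriv_le_deriv_variationOnFromTo {g : ℝ → ℝ}
    (hg : LocallyBoundedVariationOn g (Icc a b)) (hd : ∀ t ∈ Ioo a b, DifferentiableAt ℝ g t) :
    ∀ᵐ t : ℝ, t ∈ Ioo a b → |deriv g t| ≤ deriv (variationOnFromTo g (Icc a b) a) t := by
  rcases le_or_gt b a with hba | hab
  · exact Eventually.of_forall fun t ht => absurd (ht.1.trans ht.2) hba.not_gt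
  have ha : a ∈ Icc a b := left_mem_Icc.2 hab.le
  have hV := variationOnFromTo.monotoneOn hg ha
  filter_upwards [hV.ae_differentiableWithinAt_of_mem] with t hVt ht
  have hnhds : Icc a b ∈ 𝓝 t := Icc_mem_nhds ht.1 ht.2
  have htI := Ioo_subset_Icc_self ht
  have hderiv : 0 ≤ deriv (variationOnFromTo g (Icc a b) a) t := by
    rw [← derivWithin_of_mem_nhds hnhds]
    exact hV.derivWithin_nonneg
  rw [← abs_of_nonneg hderiv, ← one_mul |deriv (variationOnFromTo _ _ _) t|]
  refine abs_deriv_le_of_eventually (nhdsGT_le_nhdsNE t) (hd t ht)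
    ((hVt htI).differentiableAt hnhds) ?_
  filter_upwards [self_mem_nhdsWithin, nhdsWithin_le_nhds hnhds] with s hts hs
  rw [one_mul]
  exact (variationOnFromTo.abs_sub_le_sub_of_le hg ha htI hs (le_of_lt hts)).trans (le_abs_self _)

theorem intervalIntegrable_deriv_of_boundedVariationOn {g : ℝ → ℝ} (hab : a ≤ b)
    (hg : BoundedVariationOn g (Icc a b)) : IntervalIntegrable (deriv g) volume a b := by
  apply BoundedVariationOn.intervalIntegrable_deriv
  rwa [uIcc_of_le hab]

theorem integral_abs_deriv_le_eVariationOn {g : ℝ → ℝ} (hab : a ≤ b)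
    (hg : BoundedVariationOn g (Icc a b)) (hd : ∀ t ∈ Ioo a b, DifferentiableAt ℝ g t) :
    ∫ t in a..b, |deriv g t| ≤ (eVariationOn g (Icc a b)).toReal := by
  have hloc := hg.locallyBoundedVariationOn
  have hV : MonotoneOn (variationOnFromTo g (Icc a b) a) (uIcc a b) := by
    rw [uIcc_of_le hab]
    exact variationOnFromTo.monotoneOn hloc (left_mem_Icc.2 hab)
  calc ∫ t in a..b, |deriv g t| ≤ ∫ t in a..b, deriv (variationOnFromTo g (Icc a b) a) t := by
        refine intervalIntegral.integral_mono_ae_restrict hab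
          (intervalIntegrable_deriv_of_boundedVariationOn hab hg).abs
          hV.intervalIntegrable_deriv ?_
        rw [← restrict_Ioo_eq_restrict_Icc]
        exact (ae_restrict_iff' measurableSet_Ioo).2
          (ae_abs_deriv_le_deriv_variationOnFromTo hloc hd)
    _ ≤ variationOnFromTo g (Icc a b) a b - variationOnFromTo g (Icc a b) a a := by
        have hmem := hV.intervalIntegral_deriv_mem_uIcc
        rw [uIcc_of_le (sub_nonneg.2 (hV left_mem_uIcc right_mem_uIcc hab))] at hmem
        exact hmem.2
    _ = (eVariationOn g (Icc a b)).toReal := by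
        rw [variationOnFromTo.self, variationOnFromTo.eq_of_le _ _ hab, inter_self, sub_zero]

theorem lipschitzWith_withLp_fst : LipschitzWith 1 fun p : WithLp 2 (ℝ × ℝ) => p.fst :=
  LipschitzWith.of_edist_le WithLp.edist_fst_le

theorem eVariationOn_fst_le (γ : ℝ → ℝ × ℝ) :
    eVariationOn (fun t => (γ t).1) (Icc 0 1) ≤ curveLength γ := by
  have hle := (lipschitzWith_withLp_fst.lipschitzOnWith (s := univ)).comp_eVariationOn_le
    (g := fun t => WithLp.toLp 2 (γ t)) (s := Icc (0 : ℝ) 1) (mapsTo_univ _ _)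
  rw [ENNReal.coe_one, one_mul] at hle
  exact hle

theorem eVariationOn_snd_le (γ : ℝ → ℝ × ℝ) :
    eVariationOn (fun t => (γ t).2) (Icc 0 1) ≤ curveLength γ := by
  have hsnd : LipschitzWith 1 fun p : WithLp 2 (ℝ × ℝ) => p.snd :=
    LipschitzWith.of_edist_le WithLp.edist_snd_le
  have hle := (hsnd.lipschitzOnWith (s := univ)).comp_eVariationOn_le
    (g := fun t => WithLp.toLp 2 (γ t)) (s := Icc (0 : ℝ) 1) (mapsTo_univ _ _)
  rw [ENNReal.coe_one, one_mul] at hle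
  exact hle

theorem abs_sub_le_of_eVariationOn_le {g : ℝ → ℝ} {S : Set ℝ} {ε s t : ℝ} (hε : 0 ≤ ε)
    (hg : eVariationOn g S ≤ ENNReal.ofReal ε) (hs : s ∈ S) (ht : t ∈ S) : |g s - g t| ≤ ε := by
  have hedist := (eVariationOn.edist_le g hs ht).trans hg
  rw [edist_dist, Real.dist_eq] at hedist
  exact (ENNReal.ofReal_le_ofReal_iff hε).1 hedist

theorem abs_sub_le_mul_integral_of_ae_abs_deriv_le {r φ : ℝ → ℝ} {A : ℝ} (hab : a ≤ b)
    (hφc : ContinuousOn φ (Icc a b)) (hφd : ∀ t ∈ Ioo a b, DifferentiableAt ℝ φ t)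
    (hφi : IntervalIntegrable (deriv φ) volume a b)
    (hri : IntervalIntegrable (deriv r) volume a b)
    (h : ∀ᵐ t : ℝ, t ∈ Ioo a b → |deriv φ t| ≤ A * |deriv r t|) :
    |φ b - φ a| ≤ A * ∫ t in a..b, |deriv r t| := by
  rw [← intervalIntegral.integral_eq_sub_of_hasDerivAt_of_le hab hφc
    (fun t ht => (hφd t ht).hasDerivAt) hφi, ← intervalIntegral.integral_const_mul]
  refine (intervalIntegral.abs_integral_le_integral_abs hab).trans
    (intervalIntegral.integral_mono_ae_restrict hab hφi.abs (hri.abs.const_mul A) ?_)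
  rw [← restrict_Ioo_eq_restrict_Icc]
  exact (ae_restrict_iff' measurableSet_Ioo).2 h

theorem forall_lt_of_forall_Ioc_le {v : ℝ → ℝ} {B : ℝ} (hv : ContinuousOn v (Icc a b))
    (h : ∀ c ∈ Icc a b, (∀ t ∈ Ioc c b, v t ≤ B) → v c < B) : ∀ t ∈ Icc a b, v t < B := by
  by_contra! hex
  obtain ⟨t₀, ht₀, hBt₀⟩ := hex
  have hcompact : IsCompact (Icc a b ∩ v ⁻¹' Ici B) :=
    isCompact_Icc.of_isClosed_subset (hv.preimage_isClosed_of_isClosed isClosed_Icc isClosed_Ici)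
      inter_subset_left
  obtain ⟨c, hc, hmax⟩ := hcompact.exists_isGreatest ⟨t₀, ht₀, hBt₀⟩
  refine (h c hc.1 fun t ht => ?_).not_ge hc.2
  by_contra! hlt
  exact (hmax ⟨⟨hc.1.1.trans ht.1.le, ht.2⟩, hlt.le⟩).not_gt ht.1

/-- Going back from `b`: at the last time at which `u ∘ φ ≥ B` the bound on `|φ'|` still applies on
the remaining piece of the curve, and it forces `u ∘ φ < B` at that time. -/
theorem abs_sub_le_of_bootstrap {r φ u : ℝ → ℝ} {A B ε : ℝ} (hab : a ≤ b) (hA : 0 ≤ A)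
    (hu : LipschitzWith 1 u) (hφc : ContinuousOn φ (Icc a b))
    (hφd : ∀ t ∈ Ioo a b, DifferentiableAt ℝ φ t)
    (hφi : IntervalIntegrable (deriv φ) volume a b)
    (hri : IntervalIntegrable (deriv r) volume a b) (hr : ∫ t in a..b, |deriv r t| ≤ ε)
    (h : ∀ᵐ t : ℝ, t ∈ Ioo a b → u (φ t) ≤ B → |deriv φ t| ≤ A * |deriv r t|)
    (hend : u (φ b) + A * ε < B) : |φ a - φ b| ≤ A * ε := by
  have hfrom : ∀ c ∈ Icc a b, (∀ t ∈ Ioc c b, u (φ t) ≤ B) → |φ c - φ b| ≤ A * ε := by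
    intro c hc hB
    have hsub : uIcc c b ⊆ uIcc a b := by
      rw [uIcc_of_le hc.2, uIcc_of_le hab]
      exact Icc_subset_Icc_left hc.1
    have hsmall : ∫ t in c..b, |deriv r t| ≤ ε :=
      (intervalIntegral.integral_mono_interval hc.1 hc.2 le_rfl
        (Eventually.of_forall fun t => abs_nonneg _) hri.abs).trans hr
    rw [abs_sub_comm]
    refine (abs_sub_le_mul_integral_of_ae_abs_deriv_le hc.2 (hφc.mono (Icc_subset_Icc_left hc.1))
      (fun t ht => hφd t ⟨hc.1.trans_lt ht.1, ht.2⟩) (hφi.mono_set hsub) (hri.mono_set hsub)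
      ?_).trans (mul_le_mul_of_nonneg_left hsmall hA)
    filter_upwards [h] with t hderiv ht
    exact hderiv ⟨hc.1.trans_lt ht.1, ht.2⟩ (hB t (Ioo_subset_Ioc_self ht))
  have hbelow : ∀ t ∈ Icc a b, u (φ t) < B :=
    forall_lt_of_forall_Ioc_le (hu.continuous.comp_continuousOn hφc) fun c hc hB => by
      have hlip : |u (φ c) - u (φ b)| ≤ |φ c - φ b| := by
        simpa [Real.dist_eq] using hu.dist_le_mul (φ c) (φ b)
      linarith [le_abs_self (u (φ c) - u (φ b)), hfrom c hc hB]
  exact hfrom a (left_mem_Icc.2 hab) fun t ht => (hbelow t (Ioc_subset_Icc_self ht)).le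

end Length

/-! ### Unstable curves in the cusp -/

section UnstableCurves

variable {f : ℝ → ℝ} {K C R δ : ℝ} {ζ w : ℝ × ℝ} {γ : ℝ → ℝ × ℝ}

theorem CuspBounds.ae_abs_deriv_snd_le (hb : CuspBounds f K C R δ) (hf : IsProfile f) {M : ℝ}
    (hM : 0 ≤ M) (hγ : IsUnstableCurve f ζ w γ)
    (hvar : ∀ s ∈ Icc (0 : ℝ) 1, ∀ t ∈ Icc (0 : ℝ) 1, |(γ s).1 - (γ t).1| ≤ δ)
    (hR : ∀ t ∈ Icc (0 : ℝ) 1, R ≤ (γ t).1) :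
    ∀ᵐ t : ℝ, t ∈ Ioo (0 : ℝ) 1 → Real.sin (γ t).2 ≤ M * wallSlope f (γ t).1 →
      |deriv (fun s => (γ s).2) t| ≤
        (K * (1 + M) ^ 2 + C) * wallSlope f (γ t).1 * |deriv (fun s => (γ s).1) t| := by
  have hsing : ∀ i, i ≠ 0 → ∀ᵐ t : ℝ, t ∈ {t ∈ Ioo (0 : ℝ) 1 | γ t ∈ singMinus f i} →
      DifferentiableAt ℝ (fun s => (γ s).2) t → DifferentiableAt ℝ (fun s => (γ s).1) t →
        |deriv (fun s => (γ s).2) t| ≤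
          C * wallSlope f (γ t).1 * |deriv (fun s => (γ s).1) t| := fun i hi =>
    ae_abs_deriv_le_of_forall_mem (H := fun t => C * wallSlope f (γ t).1) fun t ht s hs =>
      hb.lipschitz i hi _ ht.2 _ hs.2 (hR t (Ioo_subset_Icc_self ht.1))
        (hR s (Ioo_subset_Icc_self hs.1))
        (hvar s (Ioo_subset_Icc_self hs.1) t (Ioo_subset_Icc_self ht.1))
  filter_upwards [hsing 1 (by decide), hsing 2 (by decide)] with t hsing₁ hsing₂ ht hsin
  have hmem := hγ.mem_phaseSpace t ht
  have hd := hγ.differentiable t ht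
  have hη := hf.wallSlope_pos hmem.1
  have hnonneg : 0 ≤ wallSlope f (γ t).1 * |deriv (fun s => (γ s).1) t| :=
    mul_nonneg hη.le (abs_nonneg _)
  have hcone := mul_nonneg (mul_nonneg hb.cone_pos.le (sq_nonneg (1 + M))) hnonneg
  by_cases hs : γ t ∈ singMinusSet f
  · have hle := hs.elim (fun hs => hsing₁ ⟨ht, hs⟩ hd.snd hd.fst)
      fun hs => hsing₂ ⟨ht, hs⟩ hd.snd hd.fst
    linarith
  · have hle := hb.cone_le M hM _ hmem (hR t (Ioo_subset_Icc_self ht)) hsin _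
      (hγ.deriv_mem t ht hs)
    have hfst : HasDerivAt (fun s => (γ s).1) (deriv γ t).1 t := hd.hasDerivAt.fst
    have hsnd : HasDerivAt (fun s => (γ s).2) (deriv γ t).2 t := hd.hasDerivAt.snd
    rw [← hfst.deriv, ← hsnd.deriv] at hle
    linarith [mul_nonneg hb.curve_pos.le hnonneg]

theorem CuspBounds.ae_abs_deriv_snd_le_source (hb : CuspBounds f K C R δ) (hf : IsProfile f)
    {B : ℝ} (hB : 0 ≤ B) (hγ : IsUnstableCurve f ζ w γ)
    (hvar : ∀ s ∈ Icc (0 : ℝ) 1, ∀ t ∈ Icc (0 : ℝ) 1, |(γ s).1 - (γ t).1| ≤ δ)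
    (hR : ∀ t ∈ Icc (0 : ℝ) 1, R ≤ (γ t).1) :
    ∀ᵐ t : ℝ, t ∈ Ioo (0 : ℝ) 1 → Real.sin (γ t).2 ≤ B * wallSlope f ζ.1 →
      |deriv (fun s => (γ s).2) t| ≤
        2 * (K * (1 + 2 * B) ^ 2 + C) * wallSlope f ζ.1 * |deriv (fun s => (γ s).1) t| := by
  have h₀ : (0 : ℝ) ∈ Icc (0 : ℝ) 1 := left_mem_Icc.2 zero_le_one
  have hK := hb.cone_pos
  have hC := hb.curve_pos
  filter_upwards [hb.ae_abs_deriv_snd_le hf (mul_nonneg zero_le_two hB) hγ hvar hR]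
    with t ht htI hsin
  have htI' := Ioo_subset_Icc_self htI
  have hslope : wallSlope f (γ t).1 ≤ 2 * wallSlope f ζ.1 := hγ.source ▸
    hb.wallSlope_le _ _ (hR t htI') (hR 0 h₀) (hvar t htI' 0 h₀)
  have hslope' : wallSlope f ζ.1 ≤ 2 * wallSlope f (γ t).1 := hγ.source ▸
    hb.wallSlope_le _ _ (hR 0 h₀) (hR t htI') (hvar 0 h₀ t htI')
  refine (ht htI (hsin.trans ?_)).trans (mul_le_mul_of_nonneg_right ?_ (abs_nonneg _))
  · linarith [mul_le_mul_of_nonneg_left hslope' hB]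
  · linarith [mul_le_mul_of_nonneg_left hslope
      (show 0 ≤ K * (1 + 2 * B) ^ 2 + C by positivity)]

theorem CuspBounds.abs_snd_sub_le (hb : CuspBounds f K C R δ) (hf : IsProfile f) {i : Fin 3}
    {F : Set (ℝ × ℝ)} (hF : F = singPlus f i ∨ F = singMinus f i) {A ε : ℝ}
    (hA : A = 2 * (K * (1 + 2 * (2 * C + 1)) ^ 2 + C)) (hε : 0 ≤ ε) (hεδ : ε ≤ δ)
    (hεA : A * ε ≤ 1 / 2) (hζ : R + ε ≤ ζ.1) (hw : w ∈ F) (hγ : IsUnstableCurve f ζ w γ)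
    (hlen : curveLength γ ≤ ENNReal.ofReal ε) : |ζ.2 - w.2| ≤ A * wallSlope f ζ.1 * ε := by
  have hC := hb.curve_pos
  have hK := hb.cone_pos
  have hlen₁ := (eVariationOn_fst_le γ).trans hlen
  have hbv₁ : BoundedVariationOn (fun t => (γ t).1) (Icc 0 1) :=
    ne_top_of_le_ne_top ENNReal.ofReal_ne_top hlen₁
  have hbv₂ : BoundedVariationOn (fun t => (γ t).2) (Icc 0 1) :=
    ne_top_of_le_ne_top ENNReal.ofReal_ne_top ((eVariationOn_snd_le γ).trans hlen)
  have hvar : ∀ s ∈ Icc (0 : ℝ) 1, ∀ t ∈ Icc (0 : ℝ) 1, |(γ s).1 - (γ t).1| ≤ ε :=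
    fun s hs t ht => abs_sub_le_of_eVariationOn_le (g := fun t => (γ t).1) hε hlen₁ hs ht
  have h₀ : (0 : ℝ) ∈ Icc (0 : ℝ) 1 := left_mem_Icc.2 zero_le_one
  have h₁ : (1 : ℝ) ∈ Icc (0 : ℝ) 1 := right_mem_Icc.2 zero_le_one
  have hR : ∀ t ∈ Icc (0 : ℝ) 1, R ≤ (γ t).1 := fun t ht => by
    have hdist := (abs_le.1 (hvar 0 h₀ t ht)).2
    rw [hγ.source] at hdist
    linarith
  have hη := hf.wallSlope_pos (hb.radius_pos.trans_le (hγ.source ▸ hR 0 h₀))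
  have hend : Real.sin w.2 ≤ 2 * C * wallSlope f ζ.1 := by
    have hsin := hb.sin_le i F hF w hw (hγ.target ▸ hR 1 h₁)
    have hslope := hb.wallSlope_le _ _ (hR 1 h₁) (hR 0 h₀) ((hvar 1 h₁ 0 h₀).trans hεδ)
    rw [hγ.source, hγ.target] at hslope
    linarith [mul_le_mul_of_nonneg_left hslope hC.le]
  have hderiv := hb.ae_abs_deriv_snd_le_source hf (B := 2 * C + 1) (by positivity) hγ
    (fun s hs t ht => (hvar s hs t ht).trans hεδ) hR
  rw [← hA] at hderiv
  have hfst := integral_abs_deriv_le_eVariationOn zero_le_one hbv₁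
    fun t ht => (hγ.differentiable t ht).fst
  have hle := abs_sub_le_of_bootstrap (r := fun s => (γ s).1) (φ := fun s => (γ s).2) zero_le_one
    (by rw [hA]; positivity) Real.lipschitzWith_sin hγ.continuousOn.snd
    (fun t ht => (hγ.differentiable t ht).snd)
    (intervalIntegrable_deriv_of_boundedVariationOn zero_le_one hbv₂)
    (intervalIntegrable_deriv_of_boundedVariationOn zero_le_one hbv₁)
    (hfst.trans (ENNReal.toReal_le_of_le_ofReal hε hlen₁)) hderiv
    (by rw [hγ.target]; nlinarith)
  rwa [hγ.source, hγ.target] at hle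

theorem IsProfile.exists_abs_snd_sub_le (hf : IsProfile f) (h₂ : A2 f) (h₄ : A4 f) :
    ∃ C R ε₀ : ℝ, 0 < C ∧ 0 < R ∧ 0 < ε₀ ∧ ∀ i : Fin 3, ∀ F, F = singPlus f i ∨ F = singMinus f i →
      ∀ ζ : ℝ × ℝ, ∀ w ∈ F, ∀ γ ε, 0 ≤ ε → ε ≤ ε₀ → R ≤ ζ.1 → IsUnstableCurve f ζ w γ →
        curveLength γ ≤ ENNReal.ofReal ε → |ζ.2 - w.2| ≤ C * wallSlope f ζ.1 * ε := by
  obtain ⟨K, C, R, δ, hb⟩ := hf.exists_cuspBounds h₂ h₄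
  have hK := hb.cone_pos
  have hC := hb.curve_pos
  set A := 2 * (K * (1 + 2 * (2 * C + 1)) ^ 2 + C) with hA
  have hA₀ : 0 < A := by positivity
  refine ⟨A, R + δ, min δ (1 / (2 * A)), hA₀, add_pos hb.radius_pos hb.scale_pos,
    lt_min hb.scale_pos (by positivity), fun i F hF ζ w hw γ ε hε hεε₀ hζ hγ hlen => ?_⟩
  obtain ⟨hεδ, hεA⟩ := le_min_iff.1 hεε₀
  have hsmall : A * ε ≤ 1 / 2 := by
    rw [le_div_iff₀ (by positivity)] at hεA
    linarith
  exact hb.abs_snd_sub_le hf hF hA hε hεδ hsmall (by linarith) hw hγ hlen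

end UnstableCurves

/-! ### Measure of neighbourhoods of monotone graphs -/

section Neighbourhoods

theorem intervalIntegral_shift_sub_le_of_monotone {G : ℝ → ℝ} (hG : Monotone G) {b ε N : ℝ}
    (hG₀ : ∀ r, 0 ≤ G r) (hGb : ∀ r, G r ≤ b) (hε : 0 ≤ ε) :
    ∫ r in (0 : ℝ)..N, (G (r + ε) - G (r - ε)) ≤ 2 * ε * b := by
  have hintegrable : ∀ x y : ℝ, IntervalIntegrable G volume x y := fun x y => hG.intervalIntegrable
  have hright : Monotone fun r => G (r + ε) := fun x y h => hG (add_le_add_left h ε)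
  have hleft : Monotone fun r => G (r - ε) := fun x y h => hG (sub_le_sub_right h ε)
  have hlast : ∫ r in (N - ε)..(N + ε), G r ≤ 2 * ε * b := by
    have hle := intervalIntegral.integral_mono_on (show N - ε ≤ N + ε by linarith) (hintegrable _ _)
      (intervalIntegrable_const (c := b)) fun r _ => hGb r
    rw [intervalIntegral.integral_const, smul_eq_mul] at hle
    linarith
  have hfirst : 0 ≤ ∫ r in (0 - ε)..(0 + ε), G r :=
    intervalIntegral.integral_nonneg (by linarith) fun r _ => hG₀ r
  rw [intervalIntegral.integral_sub hright.intervalIntegrable hleft.intervalIntegrable,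
    intervalIntegral.integral_comp_add_right, intervalIntegral.integral_comp_sub_right,
    intervalIntegral.integral_interval_sub_interval_comm (hintegrable _ _) (hintegrable _ _)
      (hintegrable _ _),
    intervalIntegral.integral_symm (N - ε), intervalIntegral.integral_symm (0 - ε)]
  linarith

theorem integrableOn_shift_sub_of_monotone {G : ℝ → ℝ} (hG : Monotone G) {b ε : ℝ}
    (hG₀ : ∀ r, 0 ≤ G r) (hGb : ∀ r, G r ≤ b) (hε : 0 ≤ ε) :
    IntegrableOn (fun r => G (r + ε) - G (r - ε)) (Ioi 0) := by
  have hright : Monotone fun r => G (r + ε) := fun x y h => hG (add_le_add_left h ε)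
  have hleft : Monotone fun r => G (r - ε) := fun x y h => hG (sub_le_sub_right h ε)
  refine integrableOn_Ioi_of_intervalIntegral_norm_bounded (l := atTop) (b := fun N : ℝ => N)
    (2 * ε * b) 0 (fun N => (hright.intervalIntegrable.sub hleft.intervalIntegrable).1)
    tendsto_id (Eventually.of_forall fun N => ?_)
  have hnorm : ∀ r, ‖G (r + ε) - G (r - ε)‖ = G (r + ε) - G (r - ε) := fun r =>
    Real.norm_of_nonneg (sub_nonneg.2 (hG (by linarith)))
  simp only [hnorm]
  exact intervalIntegral_shift_sub_le_of_monotone hG hG₀ hGb hε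

theorem integral_shift_sub_le_of_monotone {G : ℝ → ℝ} (hG : Monotone G) {b ε : ℝ}
    (hG₀ : ∀ r, 0 ≤ G r) (hGb : ∀ r, G r ≤ b) (hε : 0 ≤ ε) :
    ∫ r in Ioi (0 : ℝ), (G (r + ε) - G (r - ε)) ≤ 2 * ε * b :=
  le_of_tendsto (intervalIntegral_tendsto_integral_Ioi 0
    (integrableOn_shift_sub_of_monotone hG hG₀ hGb hε) tendsto_id)
    (Eventually.of_forall fun _ => intervalIntegral_shift_sub_le_of_monotone hG hG₀ hGb hε)

theorem volume_setOf_mem_Icc {l u : ℝ → ℝ} {s : Set ℝ} (hl : Measurable l) (hu : Measurable u)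
    (hs : MeasurableSet s) :
    volume {p : ℝ × ℝ | p.1 ∈ s ∧ p.2 ∈ Icc (l p.1) (u p.1)} =
      ∫⁻ r in s, ENNReal.ofReal (u r - l r) := by
  have hmeas : MeasurableSet {p : ℝ × ℝ | p.1 ∈ s ∧ p.2 ∈ Icc (l p.1) (u p.1)} :=
    (measurable_fst hs).inter ((measurableSet_le (hl.comp measurable_fst) measurable_snd).inter
      (measurableSet_le measurable_snd (hu.comp measurable_fst)))
  rw [Measure.volume_eq_prod, Measure.prod_apply hmeas, ← lintegral_indicator hs]
  refine lintegral_congr fun r => ?_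
  by_cases hr : r ∈ s
  · rw [indicator_of_mem hr, ← Real.volume_Icc]
    congr 1
    ext y
    simp [hr]
  · simp [hr]

/-- The least monotone function with nonnegative values whose graph lies above the set `S`; the
value is only meaningful when `S` is bounded above. -/
noncomputable def monotoneEnvelope (S : Set (ℝ × ℝ)) (r : ℝ) : ℝ :=
  sSup (insert 0 (Prod.snd '' {w ∈ S | w.1 ≤ r}))

section monotoneEnvelope

variable {S : Set (ℝ × ℝ)} {b r : ℝ}

theorem monotoneEnvelope_le (hb : 0 ≤ b) (hS : ∀ w ∈ S, w.1 ≤ r → w.2 ≤ b) :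
    monotoneEnvelope S r ≤ b := by
  refine csSup_le (insert_nonempty _ _) ?_
  rintro y (rfl | ⟨w, hw, rfl⟩)
  exacts [hb, hS w hw.1 hw.2]

theorem le_monotoneEnvelope (hS : ∀ w ∈ S, w.2 ≤ b) {y : ℝ}
    (hy : y ∈ insert 0 (Prod.snd '' {w ∈ S | w.1 ≤ r})) : y ≤ monotoneEnvelope S r := by
  refine le_csSup (BddAbove.insert 0 ⟨b, ?_⟩) hy
  rintro _ ⟨w, hw, rfl⟩
  exact hS w hw.1

theorem monotone_monotoneEnvelope (hS : ∀ w ∈ S, w.2 ≤ b) : Monotone (monotoneEnvelope S) :=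
  fun _ _ hrr' => monotoneEnvelope_le (le_monotoneEnvelope hS (mem_insert _ _)) fun w hw hwr =>
    le_monotoneEnvelope hS (mem_insert_of_mem _ ⟨w, ⟨hw, hwr.trans hrr'⟩, rfl⟩)

end monotoneEnvelope

theorem volume_le_of_monotone_graph {S A : Set (ℝ × ℝ)} {b ε : ℝ} {h : ℝ → ℝ} (hb : 0 ≤ b)
    (hε : 0 ≤ ε) (hS : ∀ w ∈ S, 0 ≤ w.2 ∧ w.2 ≤ b)
    (hmono : ∀ w ∈ S, ∀ w' ∈ S, w.1 ≤ w'.1 → w.2 ≤ w'.2) (hh : Measurable h)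
    (hh₀ : ∀ r, 0 ≤ h r) (hintegrable : IntegrableOn h (Ioi 0))
    (hA : ∀ ζ ∈ A, 0 < ζ.1 ∧ ∃ w ∈ S, |ζ.1 - w.1| ≤ ε ∧ |ζ.2 - w.2| ≤ ε * h ζ.1) :
    volume A ≤ ENNReal.ofReal (2 * (b + ∫ r in Ioi (0 : ℝ), h r) * ε) := by
  set G := monotoneEnvelope S
  have hSb : ∀ w ∈ S, w.2 ≤ b := fun w hw => (hS w hw).2
  have hG : Monotone G := monotone_monotoneEnvelope hSb
  have hG₀ : ∀ r, 0 ≤ G r := fun r => le_monotoneEnvelope hSb (mem_insert _ _)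
  have hGb : ∀ r, G r ≤ b := fun r => monotoneEnvelope_le hb fun w hw _ => hSb w hw
  have hsub : A ⊆ {p : ℝ × ℝ | p.1 ∈ Ioi 0 ∧
      p.2 ∈ Icc (G (p.1 - ε) - ε * h p.1) (G (p.1 + ε) + ε * h p.1)} := by
    intro ζ hζ
    obtain ⟨hζ₀, w, hw, hfst, hsnd⟩ := hA ζ hζ
    rw [abs_le] at hfst hsnd
    have hupper : w.2 ≤ G (ζ.1 + ε) :=
      le_monotoneEnvelope hSb (mem_insert_of_mem _ ⟨w, ⟨hw, by linarith⟩, rfl⟩)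
    have hlower : G (ζ.1 - ε) ≤ w.2 :=
      monotoneEnvelope_le (hS w hw).1 fun w' hw' hle => hmono w' hw' w hw (by linarith)
    exact ⟨hζ₀, by linarith, by linarith⟩
  have hwidth : ∀ r, (G (r + ε) + ε * h r) - (G (r - ε) - ε * h r) =
      (G (r + ε) - G (r - ε)) + 2 * ε * h r := fun r => by ring
  have hshift := integrableOn_shift_sub_of_monotone hG hG₀ hGb hε
  have hh' : IntegrableOn (fun r => 2 * ε * h r) (Ioi 0) := hintegrable.const_mul _
  calc volume A ≤ ∫⁻ r in Ioi 0, ENNReal.ofReal ((G (r + ε) - G (r - ε)) + 2 * ε * h r) := by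
        simp only [← hwidth]
        exact (measure_mono hsub).trans_eq (volume_setOf_mem_Icc
          (l := fun r => G (r - ε) - ε * h r) (u := fun r => G (r + ε) + ε * h r)
          ((hG.measurable.comp (measurable_id.sub_const ε)).sub (hh.const_mul ε))
          ((hG.measurable.comp (measurable_id.add_const ε)).add (hh.const_mul ε))
          measurableSet_Ioi)
    _ = ENNReal.ofReal (∫ r in Ioi 0, ((G (r + ε) - G (r - ε)) + 2 * ε * h r)) :=
        (ofReal_integral_eq_lintegral_ofReal (hshift.add hh') (Eventually.of_forall fun r =>
          add_nonneg (sub_nonneg.2 (hG (by linarith)))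
            (mul_nonneg (mul_nonneg zero_le_two hε) (hh₀ r)))).symm
    _ ≤ ENNReal.ofReal (2 * (b + ∫ r in Ioi (0 : ℝ), h r) * ε) := by
        refine ENNReal.ofReal_le_ofReal ?_
        rw [integral_add hshift hh', integral_const_mul]
        linarith [integral_shift_sub_le_of_monotone hG hG₀ hGb hε]

theorem volume_preimage_reflect (A : Set (ℝ × ℝ)) :
    volume ((fun ζ : ℝ × ℝ => (ζ.1, Real.pi - ζ.2)) ⁻¹' A) = volume A :=
  ((MeasurePreserving.id volume).prod
    (Measure.measurePreserving_sub_left volume Real.pi)).measure_preimage_equiv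
      (f := (MeasurableEquiv.refl ℝ).prodCongr (MeasurableEquiv.subLeft Real.pi)) A

theorem invMeasure_le_volume : invMeasure ≤ volume :=
  calc invMeasure ≤ (volume.restrict phaseSpace).withDensity 1 :=
        withDensity_mono (Eventually.of_forall fun ζ =>
          ENNReal.ofReal_le_one.2 (Real.sin_le_one ζ.2))
    _ = volume.restrict phaseSpace := withDensity_one
    _ ≤ volume := Measure.restrict_le_self

variable {f : ℝ → ℝ}

theorem IsProfile.integrableOn_wallSlope (hf : IsProfile f) {R : ℝ} (hR : 0 < R) :
    IntegrableOn (wallSlope f) (Ioi R) := by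
  have hcos := cos_wallAngle_pos (f := f) (abscissa f R)
  have hsin : ∀ r, R < r → wallSlope f r ≤
      (Real.cos (wallAngle f (abscissa f R)))⁻¹ * Real.sin (wallAngle f (abscissa f r)) := by
    intro r hr
    have hmono : Real.cos (wallAngle f (abscissa f R)) ≤ Real.cos (wallAngle f (abscissa f r)) :=
      Real.cos_le_cos_of_nonneg_of_le_pi
        (hf.wallAngle_pos (hf.abscissa_pos (hR.trans hr))).le
        (by linarith [(wallAngle_mem (f := f) (abscissa f R)).2, Real.pi_pos])
        (hf.wallAngle_anti (hf.abscissa_pos hR) (hf.abscissa_le_abscissa hR.le hr.le))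
    rw [sin_wallAngle, ← div_eq_inv_mul, le_div_iff₀ hcos]
    exact mul_le_mul_of_nonneg_left hmono (hf.wallSlope_pos (hR.trans hr)).le
  have hheight : IntegrableOn (fun r => -Real.sin (wallAngle f (abscissa f r))) (Ioi R) :=
    integrableOn_Ioi_deriv_of_nonpos' (fun r hr => hf.hasDerivAt_height (hR.trans_le hr))
      (fun r hr => neg_nonpos.2 (hf.sin_wallAngle_pos (hf.abscissa_pos (hR.trans hr))).le)
      (hf.tendsto_zero.comp hf.tendsto_abscissa)
  have hanti : AntitoneOn (wallSlope f) (Ioi R) := fun r hr r' _ hrr' =>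
    hf.wallSlope_anti (hR.trans hr) hrr'
  refine (hheight.neg.const_mul (Real.cos (wallAngle f (abscissa f R)))⁻¹).mono'
    (aemeasurable_restrict_of_antitoneOn measurableSet_Ioi hanti).aestronglyMeasurable ?_
  filter_upwards [self_mem_ae_restrict measurableSet_Ioi] with r hr
  rw [Real.norm_of_nonneg (hf.wallSlope_pos (hR.trans hr)).le, Pi.neg_apply, neg_neg]
  exact hsin r hr

theorem IsProfile.exists_integrable_majorant (hf : IsProfile f) {C R : ℝ} (hC : 0 ≤ C)
    (hR : 0 < R) :
    ∃ h : ℝ → ℝ, Measurable h ∧ (∀ r, 0 ≤ h r) ∧ IntegrableOn h (Ioi 0) ∧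
      (∀ r, r < R → 1 ≤ h r) ∧ ∀ r, R ≤ r → C * wallSlope f r ≤ h r := by
  set k : ℝ → ℝ := fun r => C * wallSlope f (max R r)
  have hk : Antitone k := fun r r' hrr' => mul_le_mul_of_nonneg_left
    (hf.wallSlope_anti (hR.trans_le (le_max_left _ _)) (max_le_max_left R hrr')) hC
  have hk₀ : ∀ r, 0 ≤ k r := fun r =>
    mul_nonneg hC (hf.wallSlope_pos (hR.trans_le (le_max_left _ _))).le
  have hkint : IntegrableOn k (Ioi 0) := by
    rw [← Ioc_union_Ioi_eq_Ioi hR.le]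
    refine ((hk.intervalIntegrable (a := 0) (b := R)).1).union
      (IntegrableOn.congr_fun ((hf.integrableOn_wallSlope hR).const_mul C) (fun r hr => ?_)
        measurableSet_Ioi)
    simp only [k, max_eq_right (le_of_lt (mem_Ioi.1 hr))]
  have hone : IntegrableOn ((Iio R).indicator fun _ => (1 : ℝ)) (Ioi 0) := by
    rw [integrableOn_indicator_iff measurableSet_Iio, Iio_inter_Ioi]
    exact integrableOn_const measure_Ioo_lt_top.ne
  refine ⟨fun r => (Iio R).indicator (fun _ => 1) r + k r,
    (measurable_const.indicator measurableSet_Iio).add hk.measurable,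
    fun r => add_nonneg (indicator_nonneg (fun _ _ => zero_le_one) r) (hk₀ r), hone.add hkint,
    fun r hr => ?_, fun r hr => ?_⟩
  · dsimp only
    rw [indicator_of_mem (mem_Iio.2 hr)]
    exact le_add_of_nonneg_right (hk₀ r)
  · simp only [k, max_eq_right hr]
    exact le_add_of_nonneg_left (indicator_nonneg (fun _ _ => zero_le_one) r)

theorem snd_mem_of_mem_singPlus {i : Fin 3} {ζ : ℝ × ℝ} (hζ : ζ ∈ singPlus f i) :
    0 ≤ ζ.2 ∧ ζ.2 ≤ Real.pi := by
  fin_cases i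
  · exact ⟨Real.pi_pos.le.trans_eq hζ.2.symm, hζ.2.le⟩
  · exact ⟨hζ.1.2.1.le, hζ.1.2.2.le⟩
  · exact ⟨hζ.1.2.1.le, hζ.1.2.2.le⟩

theorem exists_curve_of_mem_unstableNhd {F : Set (ℝ × ℝ)} {ε ε' : ℝ} (hε : 0 ≤ ε)
    (hεε' : ε < ε') {ζ : ℝ × ℝ} (hζ : ζ ∈ unstableNhd f F ε) :
    ∃ w ∈ F, ∃ γ, IsUnstableCurve f ζ w γ ∧ curveLength γ ≤ ENNReal.ofReal ε' := by
  have hlt : unstableInfDist f ζ F < ENNReal.ofReal ε' :=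
    hζ.2.trans_lt ((ENNReal.ofReal_lt_ofReal_iff (hε.trans_lt hεε')).2 hεε')
  simp only [unstableInfDist, unstableDist, iInf_lt_iff] at hlt
  obtain ⟨w, hw, γ, hγ, hlen⟩ := hlt
  exact ⟨w, hw, γ, hγ, hlen.le⟩

theorem IsUnstableCurve.abs_fst_sub_le {ζ w : ℝ × ℝ} {γ : ℝ → ℝ × ℝ} {ε : ℝ}
    (hγ : IsUnstableCurve f ζ w γ) (hε : 0 ≤ ε) (hlen : curveLength γ ≤ ENNReal.ofReal ε) :
    |ζ.1 - w.1| ≤ ε := by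
  rw [← hγ.source, ← hγ.target]
  exact abs_sub_le_of_eVariationOn_le (g := fun t => (γ t).1) hε
    ((eVariationOn_fst_le γ).trans hlen) (left_mem_Icc.2 zero_le_one) (right_mem_Icc.2 zero_le_one)

theorem IsUnstableCurve.abs_snd_sub_le {ζ w : ℝ × ℝ} {γ : ℝ → ℝ × ℝ} {ε : ℝ}
    (hγ : IsUnstableCurve f ζ w γ) (hε : 0 ≤ ε) (hlen : curveLength γ ≤ ENNReal.ofReal ε) :
    |ζ.2 - w.2| ≤ ε := by
  rw [← hγ.source, ← hγ.target]
  exact abs_sub_le_of_eVariationOn_le (g := fun t => (γ t).2) hε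
    ((eVariationOn_snd_le γ).trans hlen) (left_mem_Icc.2 zero_le_one) (right_mem_Icc.2 zero_le_one)

theorem IsProfile.exists_near_of_mem_unstableNhd (hf : IsProfile f) (h₂ : A2 f) (h₄ : A4 f) :
    ∃ h : ℝ → ℝ, ∃ ε₀ > 0, Measurable h ∧ (∀ r, 0 ≤ h r) ∧ IntegrableOn h (Ioi 0) ∧
      ∀ i : Fin 3, ∀ F, F = singPlus f i ∨ F = singMinus f i → ∀ ε, 0 < ε → ε ≤ ε₀ →
        ∀ ζ ∈ unstableNhd f F ε, 0 < ζ.1 ∧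
          ∃ w ∈ F, |ζ.1 - w.1| ≤ 2 * ε ∧ |ζ.2 - w.2| ≤ 2 * ε * h ζ.1 := by
  obtain ⟨C, R, ε₀, hC, hR, hε₀, hbound⟩ := hf.exists_abs_snd_sub_le h₂ h₄
  obtain ⟨h, hmeas, hh₀, hintegrable, hsmall, hlarge⟩ := hf.exists_integrable_majorant hC.le hR
  refine ⟨h, ε₀ / 2, half_pos hε₀, hmeas, hh₀, hintegrable, fun i F hF ε hε hεε₀ ζ hζ => ?_⟩
  have h2ε : 0 ≤ 2 * ε := by positivity
  obtain ⟨w, hw, γ, hγ, hlen⟩ :=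
    exists_curve_of_mem_unstableNhd hε.le (show ε < 2 * ε by linarith) hζ
  refine ⟨hζ.1.1, w, hw, hγ.abs_fst_sub_le h2ε hlen, ?_⟩
  rcases lt_or_ge ζ.1 R with hr | hr
  · exact (hγ.abs_snd_sub_le h2ε hlen).trans (le_mul_of_one_le_right h2ε (hsmall ζ.1 hr))
  · rw [mul_comm (2 * ε)]
    exact (hbound i F hF ζ w hw γ _ h2ε (by linarith) hr hγ hlen).trans
      (mul_le_mul_of_nonneg_right (hlarge ζ.1 hr) h2ε)

theorem IsProfile.exists_volume_unstableNhd_le (hf : IsProfile f) (h₂ : A2 f) (h₄ : A4 f)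
    (i : Fin 3) (F : Set (ℝ × ℝ)) (hF : F = singPlus f i ∨ F = singMinus f i) :
    ∃ C > 0, ∃ ε₀ > 0, ∀ ε : ℝ, 0 < ε → ε ≤ ε₀ →
      volume (unstableNhd f F ε) ≤ ENNReal.ofReal (C * ε) := by
  obtain ⟨h, ε₀, hε₀, hmeas, hh₀, hintegrable, hnear⟩ := hf.exists_near_of_mem_unstableNhd h₂ h₄
  have hI : 0 ≤ ∫ r in Ioi (0 : ℝ), h r := integral_nonneg hh₀
  have hpi := Real.pi_pos
  refine ⟨2 * (Real.pi + ∫ r in Ioi (0 : ℝ), h r) * 2, by positivity, ε₀, hε₀,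
    fun ε hε hεε₀ => ?_⟩
  have hgraph : ∀ A : Set (ℝ × ℝ), (∀ ζ ∈ A, 0 < ζ.1 ∧ ∃ w ∈ singPlus f i,
      |ζ.1 - w.1| ≤ 2 * ε ∧ |ζ.2 - w.2| ≤ 2 * ε * h ζ.1) →
      volume A ≤ ENNReal.ofReal (2 * (Real.pi + ∫ r in Ioi (0 : ℝ), h r) * 2 * ε) := by
    intro A hA
    rw [mul_assoc _ 2 ε]
    exact volume_le_of_monotone_graph hpi.le (by positivity)
      (fun w hw => snd_mem_of_mem_singPlus hw)
      (fun w hw w' hw' => hf.snd_le_snd_of_mem_singPlus hw hw') hmeas hh₀ hintegrable hA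
  rcases hF with rfl | rfl
  · exact hgraph _ (hnear i _ (Or.inl rfl) ε hε hεε₀)
  · rw [← volume_preimage_reflect]
    refine hgraph _ fun ζ hζ => ?_
    obtain ⟨hζ₀, w, hw, hfst, hsnd⟩ := hnear i _ (Or.inr rfl) ε hε hεε₀ _ hζ
    refine ⟨hζ₀, (w.1, Real.pi - w.2), hw, hfst, ?_⟩
    change |ζ.2 - (Real.pi - w.2)| ≤ 2 * ε * h ζ.1
    rwa [show ζ.2 - (Real.pi - w.2) = -(Real.pi - ζ.2 - w.2) by ring, abs_neg]

end Neighbourhoods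

/-! ### Length of the singularity curves -/

section InfiniteLength

variable {f : ℝ → ℝ} {r m s x : ℝ}

theorem hausdorffMeasure_toLp_eq_top {F : Set (ℝ × ℝ)} {R : ℝ} (h : Ioi R ⊆ Prod.fst '' F) :
    Measure.hausdorffMeasure 1 (WithLp.toLp 2 '' F : Set (WithLp 2 (ℝ × ℝ))) = ⊤ := by
  have himage : Ioi R ⊆ (fun p : WithLp 2 (ℝ × ℝ) => p.fst) '' (WithLp.toLp 2 '' F) := by
    rwa [image_image]
  have hle := (measure_mono himage).trans
    (lipschitzWith_withLp_fst.hausdorffMeasure_image_le zero_le_one (WithLp.toLp 2 '' F))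
  rwa [hausdorffMeasure_real, Real.volume_Ioi, ENNReal.coe_one, ENNReal.one_rpow, one_mul,
    top_le_iff] at hle

theorem tangent_lt_of_strictConvexOn {g : ℝ → ℝ} {S : Set ℝ} {a b : ℝ}
    (hg : StrictConvexOn ℝ S g) (ha : a ∈ S) (hb : b ∈ S) (hd : DifferentiableAt ℝ g a)
    (hab : a ≠ b) : g a + deriv g a * (b - a) < g b := by
  rcases hab.lt_or_gt with h | h
  · have hslope := hg.deriv_lt_slope ha hb h hd
    rw [slope_def_field, lt_div_iff₀ (sub_pos.2 h)] at hslope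
    linarith
  · have hslope := hg.slope_lt_deriv hb ha h hd
    rw [slope_def_field, div_lt_iff₀ (sub_pos.2 h)] at hslope
    linarith

/-- The line element at arc length `r` that points to the left with slope `m`. -/
noncomputable def lineElement (f : ℝ → ℝ) (r m : ℝ) : ℝ × ℝ := (r, slopeAngle f (abscissa f r) m)

theorem direction_lineElement : direction f (lineElement f r m) = Real.pi - Real.arctan m :=
  sub_add_cancel _ _

theorem velocity_lineElement : velocity f (lineElement f r m) =
    (-Real.cos (Real.arctan m), -(m * Real.cos (Real.arctan m))) := by
  have hsin : Real.sin (Real.arctan m) = m * Real.cos (Real.arctan m) := by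
    rw [Real.sin_arctan, Real.cos_arctan, mul_one_div]
  rw [velocity_eq, direction_lineElement, Real.cos_pi_sub, Real.sin_pi_sub, hsin]

theorem IsProfile.lineElement_mem_phaseSpace (hf : IsProfile f) (hr : 0 < r) (hm : 0 < m) :
    lineElement f r m ∈ phaseSpace := by
  have hα := hf.wallAngle_pos (hf.abscissa_pos hr)
  have hα' := (wallAngle_mem (f := f) (abscissa f r)).2
  have hβ := Real.arctan_pos.2 hm
  have hβ' := Real.arctan_lt_pi_div_two m
  refine ⟨hr, ?_, ?_⟩ <;> dsimp only [lineElement, slopeAngle] <;> linarith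

theorem collisionPoint_lineElement {d : ℝ} (hd : 0 < d)
    (hb : |f (abscissa f r) - m * d| = f |abscissa f r - d|)
    (h : ∀ p, 0 < p → p < d → |f (abscissa f r) - m * p| < f |abscissa f r - p|) :
    collisionPoint f (lineElement f r m) = (abscissa f r - d, f (abscissa f r) - m * d) := by
  have hc := Real.cos_arctan_pos m
  have hray : ∀ t, ray f (lineElement f r m) t =
      (abscissa f r - t * Real.cos (Real.arctan m),
        f (abscissa f r) - m * (t * Real.cos (Real.arctan m))) := by
    intro t
    ext
    · rw [ray_fst, velocity_lineElement, lineElement]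
      ring
    · rw [ray_snd, velocity_lineElement, lineElement]
      ring
  have hτ : flightTime f (lineElement f r m) = d / Real.cos (Real.arctan m) := by
    refine flightTime_eq (div_pos hd hc) ?_ fun t ht htd => ?_
    · rw [hray, div_mul_cancel₀ _ hc.ne']
      exact hb
    · rw [hray]
      exact h _ (mul_pos ht hc) ((lt_div_iff₀ hc).1 htd)
  rw [collisionPoint, hτ, hray, div_mul_cancel₀ _ hc.ne']

theorem tangentialSpeed_lineElement {σ : ℝ}
    (hquadrant : quadrant f (lineElement f r (-deriv f s)) = (σ, -σ))
    (hs : |(collisionPoint f (lineElement f r (-deriv f s))).1| = s) :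
    tangentialSpeed f (lineElement f r (-deriv f s)) = -σ := by
  rw [tangentialSpeed_eq, hquadrant, hs, direction_lineElement, Real.cos_pi_sub, Real.sin_pi_sub,
    Real.arctan_neg, ← wallAngle]
  linear_combination -σ * Real.sin_sq_add_cos_sq (wallAngle f s)

theorem IsProfile.exists_isLeftSlope_of_pos (hf : IsProfile f) (hx : 0 < x) :
    ∃ m, IsLeftSlope f x m := by
  have hfx := hf.pos x hx.le
  obtain ⟨y, hy, hxy⟩ := ((hf.tendsto_zero.eventually_lt_const
    (show 0 < f x / 5 by positivity)).and (eventually_ge_atTop x)).exists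
  have hy₀ : 0 < y := hx.trans_le hxy
  have hcont : ContinuousOn (fun s => f s + -deriv f s * (x + s)) (Icc x (2 * y)) := fun s hs => by
    have hs₀ := hx.trans_le hs.1
    exact ((hf.hasDerivAt hs₀).continuousAt.add ((hf.hasDerivAt_deriv hs₀).continuousAt.neg.mul
      (continuousAt_const.add continuousAt_id))).continuousWithinAt
  have hend : f (2 * y) + -deriv f (2 * y) * (x + 2 * y) ≤ f x := by
    have h2y : 0 < 2 * y := by positivity
    have htangent := hf.tangent_le h2y hy₀.le
    have hle : f (2 * y) ≤ f y := hf.le_of_le hy₀.le (by linarith)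
    nlinarith [hf.deriv_neg h2y, hf.pos (2 * y) h2y.le]
  have hstart : f x ≤ f x + -deriv f x * (x + x) :=
    le_add_of_nonneg_right (mul_nonneg (neg_pos.2 (hf.deriv_neg hx)).le (by positivity))
  obtain ⟨s, hs, hmeet⟩ := intermediate_value_Icc' (by linarith) hcont ⟨hend, hstart⟩
  exact ⟨-deriv f s, s, hx.trans_le hs.1, rfl, hmeet.symm⟩

theorem IsProfile.eventually_exists_isTangencyAbscissa (hf : IsProfile f) :
    ∀ᶠ x in atTop, ∃ s, IsTangencyAbscissa f x s := by
  have hd : 0 < -deriv f 1 := neg_pos.2 (hf.deriv_neg one_pos)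
  filter_upwards [eventually_gt_atTop 1, eventually_ge_atTop (1 + 2 * f 1 / -deriv f 1)]
    with x hx hlarge
  have hfx := hf.pos x (by linarith)
  have hcont : ContinuousOn (fun s => -deriv f s * (x - s) - f s) (Icc 1 x) := fun s hs => by
    have hs₀ := one_pos.trans_le hs.1
    exact (((hf.hasDerivAt_deriv hs₀).continuousAt.neg.mul
      (continuousAt_const.sub continuousAt_id)).sub
      (hf.hasDerivAt hs₀).continuousAt).continuousWithinAt
  have hstart : f x ≤ -deriv f 1 * (x - 1) - f 1 := by
    have hdiv : 2 * f 1 / -deriv f 1 ≤ x - 1 := by linarith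
    rw [div_le_iff₀ hd] at hdiv
    linarith [hf.le_of_le zero_le_one hx.le]
  have hend : -deriv f x * (x - x) - f x ≤ f x := by
    rw [sub_self, mul_zero]
    linarith
  obtain ⟨s, hs, hmeet⟩ := intermediate_value_Icc' hx.le hcont ⟨hend, hstart⟩
  dsimp only at hmeet
  have hsx : s < x := hs.2.lt_of_ne fun hsx => by
    rw [hsx, sub_self, mul_zero] at hmeet
    linarith
  refine ⟨s, one_pos.trans_le hs.1, hsx, ?_⟩
  rw [div_eq_iff (sub_pos.2 hsx).ne']
  linarith

theorem IsProfile.lineElement_mem_singPlus_one (hf : IsProfile f)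
    (hconv : StrictConvexOn ℝ (Ici 0) f) (hr : 0 < r) (h : IsLeftSlope f (abscissa f r) m) :
    lineElement f r m ∈ singPlus f 1 := by
  obtain ⟨s, hs, rfl, hline⟩ := h
  have hx := hf.abscissa_pos hr
  have hm := neg_pos.2 (hf.deriv_neg hs)
  have hfs := hf.pos s hs.le
  have hcoll : collisionPoint f (lineElement f r (-deriv f s)) = (-s, f s) := by
    rw [collisionPoint_lineElement (d := abscissa f r + s) (add_pos hx hs)]
    · ext <;> dsimp only <;> linarith
    · have hheight : f (abscissa f r) - -deriv f s * (abscissa f r + s) = f s := by linarith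
      rw [hheight, sub_add_cancel_left, abs_neg, abs_of_pos hs, abs_of_pos hfs]
    · intro p hp hpd
      rw [abs_of_pos (by nlinarith)]
      rcases le_or_gt 0 (abscissa f r - p) with hleft | hleft
      · rw [abs_of_nonneg hleft]
        have hlt := hf.strictAntiOn hleft hx.le (sub_lt_self _ hp)
        nlinarith
      · rw [abs_of_neg hleft]
        have hlt := tangent_lt_of_strictConvexOn hconv hs.le (neg_pos.2 hleft).le
          (hf.differentiable₁ s hs) (by linarith)
        linarith
  have hspeed := tangentialSpeed_lineElement (f := f) (r := r) (s := s) (σ := -1)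
    (by rw [quadrant, hcoll, Real.sign_of_neg (neg_lt_zero.2 hs), Real.sign_of_pos hfs, neg_neg])
    (by rw [hcoll, abs_neg, abs_of_pos hs])
  refine ⟨hf.lineElement_mem_phaseSpace hr hm, ?_, ?_, ?_⟩
  · rw [hcoll]
    exact neg_lt_zero.2 hs
  · rwa [hcoll]
  · rw [hspeed, neg_neg, abs_one]

theorem IsProfile.lineElement_mem_singPlus_two (hf : IsProfile f)
    (hconv : StrictConvexOn ℝ (Ici 0) f) (hr : 0 < r)
    (h : IsTangencyAbscissa f (abscissa f r) s) :
    lineElement f r (-deriv f s) ∈ singPlus f 2 := by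
  obtain ⟨hs, hsx, hline⟩ := h
  rw [div_eq_iff (sub_pos.2 hsx).ne'] at hline
  have hx := hf.abscissa_pos hr
  have hm := neg_pos.2 (hf.deriv_neg hs)
  have hfs := hf.pos s hs.le
  have hcoll : collisionPoint f (lineElement f r (-deriv f s)) = (s, -f s) := by
    rw [collisionPoint_lineElement (d := abscissa f r - s) (sub_pos.2 hsx)]
    · ext <;> dsimp only <;> linarith
    · rw [sub_sub_cancel, abs_of_pos hs, ← hline, sub_add_cancel_left, abs_neg, abs_of_pos hfs]
    · intro p hp hpd
      have hleft : 0 < abscissa f r - p := by linarith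
      have hlt := hf.strictAntiOn hleft.le hx.le (sub_lt_self _ hp)
      have htangent := tangent_lt_of_strictConvexOn hconv hs.le hleft.le
        (hf.differentiable₁ s hs) (by linarith)
      rw [abs_of_pos hleft, abs_lt]
      constructor <;> nlinarith
  have hspeed := tangentialSpeed_lineElement (f := f) (r := r) (s := s) (σ := 1)
    (by rw [quadrant, hcoll, Real.sign_of_pos hs, Real.sign_of_neg (neg_lt_zero.2 hfs)])
    (by rw [hcoll, abs_of_pos hs])
  refine ⟨hf.lineElement_mem_phaseSpace hr hm, ?_, Or.inr ⟨?_, ?_⟩⟩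
  · rw [hcoll]
    exact neg_lt_zero.2 hfs
  · rwa [hcoll]
  · rw [hspeed, abs_neg, abs_one]

theorem IsProfile.exists_Ioi_subset_fst_image_singPlus (hf : IsProfile f)
    (hconv : StrictConvexOn ℝ (Ici 0) f) (i : Fin 3) :
    ∃ R : ℝ, Ioi R ⊆ Prod.fst '' singPlus f i := by
  fin_cases i
  · exact ⟨0, fun r hr => ⟨(r, Real.pi), mk_mem_prod (Ioi_subset_Ici_self hr) rfl, rfl⟩⟩
  · refine ⟨0, fun r hr => ?_⟩
    obtain ⟨m, hm⟩ := hf.exists_isLeftSlope_of_pos (hf.abscissa_pos hr)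
    exact ⟨lineElement f r m, hf.lineElement_mem_singPlus_one hconv hr hm, rfl⟩
  · obtain ⟨R, hR⟩ := eventually_atTop.1
      ((hf.tendsto_abscissa.eventually hf.eventually_exists_isTangencyAbscissa).and
        (eventually_gt_atTop 0))
    refine ⟨R, fun r hr => ?_⟩
    obtain ⟨⟨s, hs⟩, hr₀⟩ := hR r (le_of_lt hr)
    exact ⟨lineElement f r (-deriv f s), hf.lineElement_mem_singPlus_two hconv hr₀ hs, rfl⟩

theorem fst_image_singMinus (i : Fin 3) : Prod.fst '' singMinus f i = Prod.fst '' singPlus f i := by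
  ext r
  constructor
  · rintro ⟨ζ, hζ, rfl⟩
    exact ⟨_, hζ, rfl⟩
  · rintro ⟨ζ, hζ, rfl⟩
    refine ⟨(ζ.1, Real.pi - ζ.2), ?_, rfl⟩
    change (ζ.1, Real.pi - (Real.pi - ζ.2)) ∈ singPlus f i
    rwa [sub_sub_cancel]

theorem IsProfile.hausdorffMeasure_singularity_eq_top (hf : IsProfile f)
    (hconv : StrictConvexOn ℝ (Ici 0) f) {i : Fin 3} {F : Set (ℝ × ℝ)}
    (hF : F = singPlus f i ∨ F = singMinus f i) :
    Measure.hausdorffMeasure 1 (WithLp.toLp 2 '' F : Set (WithLp 2 (ℝ × ℝ))) = ⊤ := by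
  obtain ⟨R, hR⟩ := hf.exists_Ioi_subset_fst_image_singPlus hconv i
  refine hausdorffMeasure_toLp_eq_top (R := R) ?_
  rcases hF with rfl | rfl
  · exact hR
  · rwa [fst_image_singMinus]

end InfiniteLength

end CuspBilliard

open CuspBilliard in
theorem mainTheorem5_general (f : ℝ → ℝ) (hf : IsProfile f) (h₂ : A2 f) (h₄ : A4 f)
    (i : Fin 3) (F : Set (ℝ × ℝ)) (hF : F = singPlus f i ∨ F = singMinus f i) :
    (∃ C > 0, ∃ ε₀ > 0, ∀ ε : ℝ, 0 < ε → ε ≤ ε₀ →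
      invMeasure (unstableNhd f F ε) ≤ volume (unstableNhd f F ε) ∧
      volume (unstableNhd f F ε) ≤ ENNReal.ofReal (C * ε)) ∧
    Measure.hausdorffMeasure 1 (WithLp.toLp 2 '' F : Set (WithLp 2 (ℝ × ℝ))) = ⊤ := by
  refine ⟨?_, hf.hausdorffMeasure_singularity_eq_top (h₄.strictConvexOn hf) hF⟩
  obtain ⟨C, hC, ε₀, hε₀, h⟩ := hf.exists_volume_unstableNhd_le h₂ h₄ i F hF
  exact ⟨C, hC, ε₀, hε₀, fun ε hε hεε₀ => ⟨invMeasure_le_volume _, h ε hε hεε₀⟩⟩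

open CuspBilliard in
theorem mainTheorem5 (f : ℝ → ℝ) (hf : IsProfile f)
    (h₁ : A1 f) (h₂ : A2 f) (h₃ : A3 f) (h₄ : A4 f)
    (i : Fin 3) (F : Set (ℝ × ℝ)) (hF : F = singPlus f i ∨ F = singMinus f i) :
    (∃ C > 0, ∃ ε₀ > 0, ∀ ε : ℝ, 0 < ε → ε ≤ ε₀ →
      invMeasure (unstableNhd f F ε) ≤ volume (unstableNhd f F ε) ∧
      volume (unstableNhd f F ε) ≤ ENNReal.ofReal (C * ε)) ∧
    -- the curve has infinite (Euclidean) length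
    Measure.hausdorffMeasure 1 (WithLp.toLp 2 '' F : Set (WithLp 2 (ℝ × ℝ))) = ⊤ :=
  mainTheorem5_general f hf h₂ h₄ i F hF
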